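/- **Processes.** A finite-state generalized semi-Markov process (GSMP) over a set $AP$ of atomic propositions consists of: a finite set $S$ of states; for each $s\in S$ a finite set $I(s)$ of events (each with a clock of the same name) and a rate $r_{s,i}>0$ for every $i\in I(s)$; a labelling $\mathrm{Props}:S\to 2^{AP}$; for all $s,s'$, $i\in I(s)$, $i'\in I(s')$ a probability density $f(\cdot\,;s,i;s',i')$ on $(0,\infty)$ that is continuous there; and for $i\in I(s)$ transition probabilities $\mathrm{next}_i(s,s')\ge 0$ with $\sum_{s'}\mathrm{next}_i(s,s')=1$. A configuration is a pair $g=\langle s,c\rangle$ with $c\in\mathbb R^{I(s)}$. It satisfies the *uniqueness condition* if all $c_i>0$ and a unique clock $i\in I(s)$ minimizes $c_i/r_{s,i}$; this minimum is $\mathcal T(g)$. Such a configuration evolves for time $\mathcal T(g)$ with each clock $j$ decreasing at rate $r_{s,j}$; then the minimizing clock $i$ fires, the next state $s'$ is drawn from $\mathrm{next}_i(s,\cdot)$, the clocks in $I(s')\cap(I(s)\setminus\{i\})$ keep their current values, and the other clocks $i'\in I(s')$ get independent new values with densities $f(\cdot\,;s,i;s',i')$. Let $\mathcal G$ be the set of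 *generalized states*: the configurations from which almost surely all configurations of this evolution (the initial one and the one right after each jump) satisfy the uniqueness condition. A sequence $(g_n)_{n\ge0}$ in $\mathcal G$ is *finitely varying* if $\sum_n\mathcal T(g_n)=\infty$. It generates $f:[0,\infty)\to\mathcal G$: if $t_n=\sum_{j<n}\mathcal T(g_j)\le t<t_{n+1}$ and $g_n=\langle s,c\rangle$, then $f(t)=\langle s,(c_i-r_{s,i}(t-t_n))_i\rangle$. For $g\in\mathcal G$ let $\mathrm{Traces}(g)$ be the law of the evolution from $g$, on the space $\Omega$ of finitely varying sequences, identified with the functions $f$ (with the $\sigma$-algebra inherited from the product $\sigma$-algebra). **The fixed-point metric.** Pseudometrics take values in $[0,1]$. For a pseudometric $m$ on $\mathcal G$ and $f,f'\in\Omega$ let $$J(m)(f,f')=\max\Big(\sup_t\inf_{t'}\max\big(m(f(t),f'(t')),|t-t'|\big),\ \sup_{t'}\inf_{t}\max\big(m(f(t),f'(t')),|t-t'|\big)\Big),$$ and for probability measures $\mu,\nu$ on $\Omega$ let $W(d)(\mu,\nu)=\sup_h\big(\int h\,d\mu-\int h\,d\nu\big)$ over all measurable $h:\Omega\to[0,1]$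 with $|h(x)-h(y)|\le d(x,y)$ for all $x,y$. Let $\mathcal M$ be the set of pseudometrics $m$ on $\mathcal G$ with $m(\langle s,c\rangle,\langle s',c'\rangle)=1$ whenever $\mathrm{Props}(s)\ne\mathrm{Props}(s')$, ordered by $m_1\preceq m_2$ iff $m_1\ge m_2$ pointwise. For $m\in\mathcal M$, $\mathcal F_k(m)(g,g')$ is $1$ if the states of $g$ and $g'$ have different $\mathrm{Props}$, and otherwise $k\cdot W(J(m))(\mathrm{Traces}(g),\mathrm{Traces}(g'))$. **The logical metric.** Fix $0<k\le\frac12$. F- and G-function expressions are generated by $$F::=\mathbf 1\mid \mathbf p\mid\min(F,F)\mid h\circ F\mid\textstyle\int G,\qquad G::=\mathcal L(F)(t)\mid\min(G,G)\mid h\circ G,$$ with $p\in AP$, $t\in[0,\infty)$, and $h:[0,1]\to[0,1]$ satisfying $|h(x)-h(y)|\le|x-y|$. F-expressions are evaluated at $g=\langle s,c\rangle\in\mathcal G$ and G-expressions at $f\in\Omega$: $\mathbf 1(g)=1$; $\mathbf p(g)=1$ if $p\in\mathrm{Props}(s)$ and $0$ otherwise; $\min$ and $h\circ$ pointwise; $(\int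 G)(g)=k\int G(f)\,d\mathrm{Traces}(g)(f)$; and $\mathcal L(F)(t)(f)=\sup_{t'\ge0}\big(F(f(t'))-|t'-t|\big)$. Let $d_k(g,g')=\sup_F|F(g)-F(g')|$, the supremum being over all F-expressions. **Theorem.** For every finite-state GSMP and every $0<k\le\frac12$, $d_k$ is a pseudometric on $\mathcal G$, the functional $\mathcal F_k$ has a maximum fixed point $m_{\mathcal F_k}$ in $(\mathcal M,\preceq)$, and $d_k$ and $m_{\mathcal F_k}$ induce the same uniformity on $\mathcal G$, where the uniformity induced by $m$ is $\{E\subseteq\mathcal G\times\mathcal G\mid\exists\varepsilon>0:\ \{(x,y)\mid m(x,y)<\varepsilon\}\subseteq E\}$. -/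

import Mathlib

open MeasureTheory ProbabilityTheory Filter Set
open scoped NNReal ENNReal Topology

/-- A finite-state generalized semi-Markov process with states `S`, event (clock) names `E` and
atomic propositions `AP`. An event carries its name from one state to another. -/
structure GSMP (S E AP : Type*) [Fintype S] where
  /-- the finite set `I(s)` of events that compete in state `s` -/
  events : S → Finset E
  /-- the constant rate at which a clock runs down in a state -/
  rate : (s : S) → events s → ℝ
  rate_pos : ∀ s i, 0 < rate s i
  /-- the atomic propositions that are true in a state -/
  props : S → Set AP
  /-- the density `f(t; s, i; s', i')` of the new value of clock `i'` after the jump from `s`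
  to `s'` triggered by event `i` -/
  density : (s : S) → events s → (s' : S) → events s' → ℝ → ℝ
  density_nonneg : ∀ s i s' i' t, 0 < t → 0 ≤ density s i s' i' t
  density_continuousOn : ∀ s i s' i', ContinuousOn (density s i s' i') (Ioi 0)
  density_lintegral : ∀ s i s' i', ∫⁻ t in Ioi (0 : ℝ), ENNReal.ofReal (density s i s' i' t) = 1
  /-- `next s i s'` is the probability that event `i` in state `s` leads to state `s'` -/
  next : (s : S) → events s → S → ℝ
  next_nonneg : ∀ s i s', 0 ≤ next s i s'
  next_sum : ∀ s i, ∑ s', next s i s' = 1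

namespace GSMP

universe u v w

/-! ### Configurations and the jump kernel -/

section Dynamics

variable {S : Type u} {E : Type v} {AP : Type w} [Fintype S] (P : GSMP S E AP)

/-- A configuration `⟨s, c⟩`: a state and a real vector of clock values indexed by `I(s)`. -/
abbrev Config : Type (max u v) := Σ s : S, (P.events s → ℝ)

/-- Clock `i` reaches `0` strictly before all other clocks of the configuration. -/
def IsFirst (g : P.Config) (i : P.events g.1) : Prop :=
  ∀ j, j ≠ i → g.2 i / P.rate g.1 i < g.2 j / P.rate g.1 j

/-- All clocks are running (positive), and exactly one of them reaches `0` first. -/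
def HasUniqueFirst (g : P.Config) : Prop :=
  (∀ i, 0 < g.2 i) ∧ ∃ i, P.IsFirst g i

/-- The time `𝒯(g)` until the first clock reaches `0`. -/
noncomputable def holdTime (g : P.Config) : ℝ := ⨅ i, g.2 i / P.rate g.1 i

/-- The configuration reached from `g` after time `t` without a jump. -/
def evolve (g : P.Config) (t : ℝ) : P.Config := ⟨g.1, fun i => g.2 i - P.rate g.1 i * t⟩

open Classical in
/-- The clock values after the jump of `g` to the state `s'` triggered by event `i`: the clocks in
`I(s') ∩ (I(s) \ {i})` carry forward their values, the others take their values from `z`. -/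
noncomputable def newClocks (g : P.Config) (i : P.events g.1) (s' : S) (z : P.events s' → ℝ) :
    P.events s' → ℝ := fun j =>
  if h : j.1 ∈ P.events g.1 ∧ j.1 ≠ i.1 then
    g.2 ⟨j.1, h.1⟩ - P.rate g.1 ⟨j.1, h.1⟩ * P.holdTime g
  else z j

/-- The distribution of a newly set clock. -/
noncomputable def lifetime (s : S) (i : P.events s) (s' : S) (j : P.events s') : Measure ℝ :=
  (volume.restrict (Ioi 0)).withDensity fun t => ENNReal.ofReal (P.density s i s' j t)

/-- The distribution of the next configuration when event `i` fires in `g`: the next state is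
chosen by `next`, and the new clocks are set independently. (The draws for the clocks that are
carried forward are discarded by `newClocks`.) -/
noncomputable def jumpBy (g : P.Config) (i : P.events g.1) : Measure P.Config :=
  ∑ s', ENNReal.ofReal (P.next g.1 i s') •
    (Measure.pi (P.lifetime g.1 i s')).map fun z => (⟨s', P.newClocks g i s' z⟩ : P.Config)

open Classical in
/-- The distribution of the configuration after the next jump. (Configurations without a first
clock have no evolution; the value for these is never used.) -/
noncomputable def jump (g : P.Config) : Measure P.Config :=
  if h : ∃ i, P.IsFirst g i then P.jumpBy g h.choose else Measure.dirac g

variable {P}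

theorem IsFirst.unique {g : P.Config} {i j : P.events g.1} (hi : P.IsFirst g i)
    (hj : P.IsFirst g j) : i = j := by
  by_contra h
  exact lt_asymm (hi j (Ne.symm h)) (hj i h)

theorem IsFirst.holdTime_eq {g : P.Config} {i : P.events g.1} (hi : P.IsFirst g i) :
    P.holdTime g = g.2 i / P.rate g.1 i := by
  apply le_antisymm
  · exact ciInf_le (Set.finite_range _).bddBelow i
  · have : Nonempty (P.events g.1) := ⟨i⟩
    refine le_ciInf fun j => ?_
    by_cases h : j = i
    · rw [h]
    · exact (hi j h).le

theorem jump_eq {g : P.Config} {i : P.events g.1} (hi : P.IsFirst g i) :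
    P.jump g = P.jumpBy g i := by
  have h : ∃ i, P.IsFirst g i := ⟨i, hi⟩
  rw [jump, dif_pos h, IsFirst.unique h.choose_spec hi]

theorem evolve_div (g : P.Config) (t : ℝ) (i : P.events g.1) :
    (P.evolve g t).2 i / P.rate g.1 i = g.2 i / P.rate g.1 i - t := by
  have := (P.rate_pos g.1 i).ne'
  simp only [evolve]
  field_simp

theorem IsFirst.evolve {g : P.Config} {i : P.events g.1} (hi : P.IsFirst g i) (t : ℝ) :
    P.IsFirst (P.evolve g t) i := by
  intro j hj
  have h1 := hi j hj
  have h2 := evolve_div g t i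
  have h3 := evolve_div g t j
  exact (h2.trans_lt (sub_lt_sub_right h1 t)).trans_eq h3.symm

theorem HasUniqueFirst.evolve {g : P.Config} (hg : P.HasUniqueFirst g) {t : ℝ}
    (ht : t < P.holdTime g) : P.HasUniqueFirst (P.evolve g t) := by
  obtain ⟨i, hi⟩ := hg.2
  refine ⟨fun j => ?_, i, hi.evolve t⟩
  have h1 : P.holdTime g ≤ g.2 j / P.rate g.1 j := ciInf_le (Set.finite_range _).bddBelow j
  have h2 := (lt_div_iff₀ (P.rate_pos g.1 j)).1 (ht.trans_le h1)
  change 0 < g.2 j - P.rate g.1 j * t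
  linarith

theorem jump_evolve {g : P.Config} (hg : ∃ i, P.IsFirst g i) (t : ℝ) :
    P.jump (P.evolve g t) = P.jump g := by
  obtain ⟨i, hi⟩ := hg
  rw [jump_eq hi, jump_eq (hi.evolve t)]
  have hT : P.holdTime (P.evolve g t) = P.holdTime g - t := by
    rw [hi.holdTime_eq, (hi.evolve t).holdTime_eq]
    exact evolve_div g t i
  have hn : ∀ s' z, P.newClocks (P.evolve g t) i s' z = P.newClocks g i s' z := by
    intro s' z
    funext j
    by_cases h : j.1 ∈ P.events g.1 ∧ j.1 ≠ i.1
    · have h1 : P.newClocks (P.evolve g t) i s' z j = g.2 ⟨j.1, h.1⟩ - P.rate g.1 ⟨j.1, h.1⟩ * t -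
          P.rate g.1 ⟨j.1, h.1⟩ * P.holdTime (P.evolve g t) := dif_pos h
      have h2 : P.newClocks g i s' z j = g.2 ⟨j.1, h.1⟩ -
          P.rate g.1 ⟨j.1, h.1⟩ * P.holdTime g := dif_pos h
      rw [h1, h2, hT]
      ring
    · have h1 : P.newClocks (P.evolve g t) i s' z j = z j := dif_neg h
      have h2 : P.newClocks g i s' z j = z j := dif_neg h
      rw [h1, h2]
  change ∑ s', ENNReal.ofReal (P.next g.1 i s') • (Measure.pi (P.lifetime g.1 i s')).map
      (fun z => (⟨s', P.newClocks (P.evolve g t) i s' z⟩ : P.Config)) = _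
  simp only [hn]
  rfl

variable (P)

/-- Almost surely, each of the configurations before the first `n` jumps, and the one after them,
has running clocks and a unique clock that reaches `0` first. -/
def Regular : ℕ → P.Config → Prop
  | 0, g => P.HasUniqueFirst g
  | n + 1, g => P.HasUniqueFirst g ∧ ∀ᵐ g' ∂P.jump g, Regular n g'

/-- `g` is a generalized state: its evolution almost surely always meets the uniqueness condition,
in `g` itself and after every number of jumps. -/
def IsGeneralized (g : P.Config) : Prop := ∀ n, P.Regular n g

/-- The set `𝒢` of generalized states. -/
abbrev GState : Type (max u v) := {g : P.Config // P.IsGeneralized g}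

variable {P}

theorem IsGeneralized.hasUniqueFirst {g : P.Config} (hg : P.IsGeneralized g) :
    P.HasUniqueFirst g := hg 0

theorem IsGeneralized.evolve {g : P.Config} (hg : P.IsGeneralized g) {t : ℝ}
    (ht : t < P.holdTime g) : P.IsGeneralized (P.evolve g t) := by
  intro n
  cases n with
  | zero => exact (hg 0).evolve ht
  | succ n =>
    refine ⟨(hg 0).evolve ht, ?_⟩
    rw [jump_evolve (hg 0).2]
    exact (hg (n + 1)).2

/-! ### The law of the run from a configuration -/

instance isProbabilityMeasure_lifetime (s : S) (i : P.events s) (s' : S) (j : P.events s') :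
    IsProbabilityMeasure (P.lifetime s i s' j) := by
  constructor
  rw [lifetime, withDensity_apply _ MeasurableSet.univ, Measure.restrict_univ]
  exact P.density_lintegral s i s' j

theorem measurable_holdTime (s : S) :
    Measurable fun c : P.events s → ℝ => P.holdTime ⟨s, c⟩ := by
  unfold holdTime
  have h (i : P.events s) : Measurable fun c : P.events s → ℝ => c i / P.rate s i :=
    (measurable_pi_apply i).div_const _
  exact Measurable.iInf h

theorem measurable_newClocks (s : S) (i : P.events s) (s' : S) :
    Measurable fun p : (P.events s → ℝ) × (P.events s' → ℝ) =>
      P.newClocks ⟨s, p.1⟩ i s' p.2 := by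
  refine measurable_pi_lambda _ fun j => ?_
  by_cases h : j.1 ∈ P.events s ∧ j.1 ≠ i.1
  · have : (fun p : (P.events s → ℝ) × (P.events s' → ℝ) => P.newClocks ⟨s, p.1⟩ i s' p.2 j) =
        fun p => p.1 ⟨j.1, h.1⟩ - P.rate s ⟨j.1, h.1⟩ * P.holdTime ⟨s, p.1⟩ := by
      funext p
      exact dif_pos h
    rw [this]
    exact ((measurable_pi_apply _).comp measurable_fst).sub
      (((measurable_holdTime s).comp measurable_fst).const_mul _)
  · have : (fun p : (P.events s → ℝ) × (P.events s' → ℝ) => P.newClocks ⟨s, p.1⟩ i s' p.2 j) =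
        fun p => p.2 j := by
      funext p
      exact dif_neg h
    rw [this]
    exact (measurable_pi_apply _).comp measurable_snd

theorem measurable_sigma_mk (s : S) :
    Measurable fun c : P.events s → ℝ => (⟨s, c⟩ : P.Config) :=
  fun _ ht => MeasurableSpace.measurableSet_iInf.1 ht s

theorem measurable_newConfig (g : P.Config) (i : P.events g.1) (s' : S) :
    Measurable fun z : P.events s' → ℝ => (⟨s', P.newClocks g i s' z⟩ : P.Config) := by
  have h1 := measurable_newClocks (P := P) g.1 i s'
  have h2 : Measurable fun z : P.events s' → ℝ => (g.2, z) := measurable_prodMk_left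
  exact (measurable_sigma_mk s').comp (h1.comp h2)

instance isProbabilityMeasure_jump (g : P.Config) : IsProbabilityMeasure (P.jump g) := by
  by_cases h : ∃ i, P.IsFirst g i
  · obtain ⟨i, hi⟩ := h
    rw [jump_eq hi]
    constructor
    rw [jumpBy, Measure.finsetSum_apply]
    have : ∀ s', (ENNReal.ofReal (P.next g.1 i s') • (Measure.pi (P.lifetime g.1 i s')).map
        (fun z => (⟨s', P.newClocks g i s' z⟩ : P.Config))) univ
          = ENNReal.ofReal (P.next g.1 i s') := by
      intro s'
      rw [Measure.smul_apply, Measure.map_apply (measurable_newConfig g i s') MeasurableSet.univ]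
      simp
    simp only [this]
    rw [← ENNReal.ofReal_sum_of_nonneg fun s' _ => P.next_nonneg g.1 i s', P.next_sum,
      ENNReal.ofReal_one]
  · rw [jump, dif_neg h]
    infer_instance

theorem measurable_jumpBy (s : S) (i : P.events s) :
    Measurable fun c : P.events s → ℝ => P.jumpBy ⟨s, c⟩ i := by
  refine Measure.measurable_of_measurable_coe _ fun A hA => ?_
  have : (fun c : P.events s → ℝ => P.jumpBy ⟨s, c⟩ i A) = fun c =>
      ∑ s', ENNReal.ofReal (P.next s i s') * Measure.pi (P.lifetime s i s')
        (Prod.mk c ⁻¹' ((fun p : (P.events s → ℝ) × (P.events s' → ℝ) =>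
          (⟨s', P.newClocks ⟨s, p.1⟩ i s' p.2⟩ : P.Config)) ⁻¹' A)) := by
    funext c
    rw [jumpBy, Measure.finsetSum_apply]
    refine Finset.sum_congr rfl fun s' _ => ?_
    rw [Measure.smul_apply, Measure.map_apply (measurable_newConfig ⟨s, c⟩ i s') hA]
    rfl
  rw [this]
  refine Finset.measurable_sum _ fun s' _ => Measurable.const_mul ?_ _
  exact measurable_measure_prodMk_left
    (((measurable_sigma_mk s').comp (measurable_newClocks s i s')) hA)

theorem measurableSet_isFirst (s : S) (i : P.events s) :
    MeasurableSet {c : P.events s → ℝ | P.IsFirst ⟨s, c⟩ i} := by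
  have : {c : P.events s → ℝ | P.IsFirst ⟨s, c⟩ i} =
      ⋂ j : P.events s, ⋂ _ : j ≠ i, {c | c i / P.rate s i < c j / P.rate s j} := by
    ext c
    simp [IsFirst]
  rw [this]
  exact MeasurableSet.iInter fun j => MeasurableSet.iInter fun _ =>
    measurableSet_lt ((measurable_pi_apply i).div_const _) ((measurable_pi_apply j).div_const _)

theorem measurable_jump : Measurable P.jump := by
  intro B hB
  refine MeasurableSpace.measurableSet_iInf.2 fun s => ?_
  change MeasurableSet ((fun c : P.events s → ℝ => P.jump ⟨s, c⟩) ⁻¹' B)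
  have : (fun c : P.events s → ℝ => P.jump ⟨s, c⟩) ⁻¹' B =
      (⋃ i : P.events s, ({c | P.IsFirst ⟨s, c⟩ i} ∩ (fun c => P.jumpBy ⟨s, c⟩ i) ⁻¹' B)) ∪
      ((⋃ i : P.events s, {c | P.IsFirst ⟨s, c⟩ i})ᶜ ∩
        (fun c => Measure.dirac (⟨s, c⟩ : P.Config)) ⁻¹' B) := by
    ext c
    by_cases h : ∃ i, P.IsFirst ⟨s, c⟩ i
    · obtain ⟨i, hi⟩ := h
      simp only [mem_preimage, mem_union, mem_iUnion, mem_inter_iff, mem_compl_iff, mem_ofPred_eq]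
      constructor
      · intro hc
        exact Or.inl ⟨i, hi, by rwa [← jump_eq hi]⟩
      · rintro (⟨j, hj, hc⟩ | ⟨hc, -⟩)
        · rwa [jump_eq hj]
        · exact absurd ⟨i, hi⟩ hc
    · simp only [mem_preimage, mem_union, mem_iUnion, mem_inter_iff, mem_compl_iff, mem_ofPred_eq]
      rw [jump, dif_neg h]
      constructor
      · exact fun hc => Or.inr ⟨h, hc⟩
      · rintro (⟨j, hj, -⟩ | ⟨-, hc⟩)
        · exact absurd ⟨j, hj⟩ h
        · exact hc
  rw [this]
  have hF : ∀ i : P.events s, MeasurableSet {c : P.events s → ℝ | P.IsFirst ⟨s, c⟩ i} :=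
    measurableSet_isFirst s
  exact (MeasurableSet.iUnion fun i => (hF i).inter (measurable_jumpBy s i hB)).union
    ((MeasurableSet.iUnion hF).compl.inter
      ((Measure.measurable_dirac.comp (measurable_sigma_mk s)) hB))

variable (P)

/-- The Markov kernel `g ↦ jump g` as a function of the last of the configurations visited so
far. -/
noncomputable def jumpKernel (n : ℕ) : Kernel ((i : Finset.Iic n) → P.Config) P.Config where
  toFun x := P.jump (x ⟨n, Finset.mem_Iic.2 le_rfl⟩)
  measurable' := measurable_jump.comp (measurable_pi_apply _)

instance isMarkovKernel_jumpKernel (n : ℕ) : IsMarkovKernel (P.jumpKernel n) :=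
  ⟨fun x => isProbabilityMeasure_jump (x ⟨n, Finset.mem_Iic.2 le_rfl⟩)⟩

/-- The law of the Markov chain of configurations that starts in `g`. -/
noncomputable def runLaw (g : P.Config) : Measure (ℕ → P.Config) :=
  Kernel.traj (X := fun _ => P.Config) P.jumpKernel 0 fun _ => g

/-! ### Finitely varying sequences and their traces -/

/-- The time of the `n`-th jump of a sequence of configurations. -/
noncomputable def jumpTime (ω : ℕ → P.Config) (n : ℕ) : ℝ :=
  ∑ k ∈ Finset.range n, P.holdTime (ω k)

/-- The finitely varying (non-Zeno) sequences of generalized states. -/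
abbrev FVSeq : Type (max u v) :=
  {ω : ℕ → P.Config // (∀ n, P.IsGeneralized (ω n)) ∧ Tendsto (P.jumpTime ω) atTop atTop}

variable {P}

theorem FVSeq.exists_lt (ω : P.FVSeq) (t : ℝ≥0) : ∃ n, (t : ℝ) < P.jumpTime ω.1 (n + 1) := by
  obtain ⟨n, hn⟩ := ((tendsto_add_atTop_iff_nat 1).2 ω.2.2).eventually_gt_atTop (t : ℝ) |>.exists
  exact ⟨n, hn⟩

open Classical in
/-- The number `n` of jumps up to time `t`: `jumpTime n ≤ t < jumpTime (n + 1)`. -/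
noncomputable def FVSeq.index (ω : P.FVSeq) (t : ℝ≥0) : ℕ := Nat.find (ω.exists_lt t)

theorem FVSeq.lt_jumpTime (ω : P.FVSeq) (t : ℝ≥0) :
    (t : ℝ) < P.jumpTime ω.1 (ω.index t + 1) := by
  classical
  exact Nat.find_spec (ω.exists_lt t)

theorem FVSeq.jumpTime_le (ω : P.FVSeq) (t : ℝ≥0) : P.jumpTime ω.1 (ω.index t) ≤ t := by
  classical
  rcases hn : ω.index t with _ | n
  · simp [jumpTime]
  · have : n < Nat.find (ω.exists_lt t) := by
      change n < ω.index t
      omega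
    exact not_lt.1 (Nat.find_min (ω.exists_lt t) this)

/-- The function `f : [0, ∞) → 𝒢` generated by a finitely varying sequence. -/
noncomputable def FVSeq.trace (ω : P.FVSeq) (t : ℝ≥0) : P.GState :=
  ⟨P.evolve (ω.1 (ω.index t)) (t - P.jumpTime ω.1 (ω.index t)), by
    refine (ω.2.1 _).evolve ?_
    have h := ω.lt_jumpTime t
    rw [jumpTime, Finset.sum_range_succ] at h
    simp only [jumpTime]
    linarith⟩

variable (P)

/-- The distribution `Traces(g)` on finitely varying sequences, from the generalized state `g`. -/
noncomputable def tracesLaw (g : P.GState) : Measure P.FVSeq :=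
  (P.runLaw g.1).comap Subtype.val

end Dynamics

/-! ### Pseudometrics, Wasserstein and Skorohod liftings -/

section Metrics

/-- A pseudometric with values in `[0, 1]`. -/
structure IsPseudometric {X : Type*} (m : X → X → ℝ) : Prop where
  nonneg : ∀ x y, 0 ≤ m x y
  le_one : ∀ x y, m x y ≤ 1
  self : ∀ x, m x x = 0
  symm : ∀ x y, m x y = m y x
  triangle : ∀ x y z, m x z ≤ m x y + m y z

/-- The uniformity (set of entourages) induced by a pseudometric. -/
def inducedUniformity {X : Type*} (m : X → X → ℝ) : Set (Set (X × X)) :=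
  {U | ∃ ε : ℝ, 0 < ε ∧ {p : X × X | m p.1 p.2 < ε} ⊆ U}

/-- The Wasserstein distance, as a supremum over the (measurable) test functions
`h : X → [0, 1]` that do not expand `m`. -/
noncomputable def wasserstein {X : Type*} [MeasurableSpace X] (m : X → X → ℝ) (μ ν : Measure X) :
    ℝ :=
  sSup {r | ∃ h : X → ℝ, Measurable h ∧ (∀ x, 0 ≤ h x ∧ h x ≤ 1) ∧
    (∀ x y, |h x - h y| ≤ m x y) ∧ r = ∫ x, h x ∂μ - ∫ x, h x ∂ν}

/-- The Skorohod `J₂` distance of two functions on `[0, ∞)`. -/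
noncomputable def skorohod {X : Type*} (m : X → X → ℝ) (f g : ℝ≥0 → X) : ℝ :=
  max (⨆ t : ℝ≥0, ⨅ t' : ℝ≥0, max (m (f t) (g t')) |(t : ℝ) - t'|)
    (⨆ t' : ℝ≥0, ⨅ t : ℝ≥0, max (m (f t) (g t')) |(t : ℝ) - t'|)

variable {S : Type u} {E : Type v} {AP : Type w} [Fintype S] (P : GSMP S E AP)

/-- The class `ℳ` of pseudometrics on `𝒢` that give distance `1` to generalized states whose
states satisfy different atomic propositions. -/
def IsAdmissible (m : P.GState → P.GState → ℝ) : Prop :=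
  IsPseudometric m ∧ ∀ g g' : P.GState, P.props g.1.1 ≠ P.props g'.1.1 → m g g' = 1

open Classical in
/-- The functional `ℱ_k` on `ℳ`. -/
noncomputable def bisimFunctional (k : ℝ) (m : P.GState → P.GState → ℝ) :
    P.GState → P.GState → ℝ := fun g g' =>
  if P.props g.1.1 ≠ P.props g'.1.1 then 1
  else k * wasserstein (fun ω ω' : P.FVSeq => skorohod m ω.trace ω'.trace)
    (P.tracesLaw g) (P.tracesLaw g')

/-- `m` is the maximum fixed point of `ℱ_k` in `ℳ` for the order `m₁ ≼ m₂ ↔ m₁ ≥ m₂` pointwise. -/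
def IsMaximumFixedPoint (k : ℝ) (m : P.GState → P.GState → ℝ) : Prop :=
  P.IsAdmissible m ∧ P.bisimFunctional k m = m ∧
    ∀ m', P.IsAdmissible m' → P.bisimFunctional k m' = m' → ∀ g g', m g g' ≤ m' g g'

end Metrics

/-! ### Function expressions -/

/-- The restriction of `h` to `[0, 1]` is a Lipschitz function (with constant `1`) into
`[0, 1]`. -/
def IsUnitLipschitz (h : ℝ → ℝ) : Prop :=
  MapsTo h (Icc 0 1) (Icc 0 1) ∧ ∀ x ∈ Icc (0 : ℝ) 1, ∀ y ∈ Icc (0 : ℝ) 1, |h x - h y| ≤ |x - y|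

mutual

/-- The syntax of F-function expressions. -/
inductive FExpr (AP : Type w) : Type w
  | one : FExpr AP
  | prop (p : AP) : FExpr AP
  | min (F₁ F₂ : FExpr AP) : FExpr AP
  | comp (h : ℝ → ℝ) (hh : IsUnitLipschitz h) (F : FExpr AP) : FExpr AP
  | integral (G : GExpr AP) : FExpr AP

/-- The syntax of G-function expressions; the times occur in the expressions `ℒ(F)(t)`. -/
inductive GExpr (AP : Type w) : Type w
  | smooth (F : FExpr AP) (t : ℝ≥0) : GExpr AP
  | min (G₁ G₂ : GExpr AP) : GExpr AP
  | comp (h : ℝ → ℝ) (hh : IsUnitLipschitz h) (G : GExpr AP) : GExpr AP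

end

section Evaluation

variable {S : Type u} {E : Type v} {AP : Type w} [Fintype S] (P : GSMP S E AP)

open Classical in
mutual

/-- The value of an F-function expression at a generalized state. -/
noncomputable def evalF (k : ℝ) : FExpr AP → P.GState → ℝ
  | .one, _ => 1
  | .prop p, g => if p ∈ P.props g.1.1 then 1 else 0
  | .min F₁ F₂, g => Min.min (evalF k F₁ g) (evalF k F₂ g)
  | .comp h _ F, g => h (evalF k F g)
  | .integral G, g => k * ∫ ω, evalG k G ω ∂P.tracesLaw g

/-- The value of a G-function expression at (the trace of) a finitely varying sequence. -/
noncomputable def evalG (k : ℝ) : GExpr AP → P.FVSeq → ℝ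
  | .smooth F t, ω => ⨆ t' : ℝ≥0, (evalF k F (ω.trace t') - |(t' : ℝ) - t|)
  | .min G₁ G₂, ω => Min.min (evalG k G₁ ω) (evalG k G₂ ω)
  | .comp h _ G, ω => h (evalG k G ω)

end

/-- The pseudometric `d_k` given by the F-function expressions. -/
noncomputable def logicalDist (k : ℝ) (g g' : P.GState) : ℝ :=
  ⨆ F : FExpr AP, |P.evalF k F g - P.evalF k F g'|

end Evaluation

end GSMP

/-! ### Homogeneous Markov chains -/

section MarkovChain

variable {X : Type*}

/-- Prepend a first element to a sequence. -/
def consSeq (x : X) (ω : ℕ → X) : ℕ → X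
  | 0 => x
  | n + 1 => ω n

/-- Prepend a first element to a finite sequence. -/
def consFin (x : X) {n : ℕ} (y : Finset.Iic n → X) (i : Finset.Iic (n + 1)) : X :=
  if h : i.1 = 0 then x
  else y ⟨i.1 - 1, Finset.mem_Iic.2 (by have := Finset.mem_Iic.1 i.2; omega)⟩

/-- Append a last element to a finite sequence. -/
def snocFin {n : ℕ} (y : Finset.Iic n → X) (x : X) (i : Finset.Iic (n + 1)) : X :=
  if h : i.1 ≤ n then y ⟨i.1, Finset.mem_Iic.2 h⟩ else x

theorem consFin_snocFin (x : X) {n : ℕ} (y : Finset.Iic n → X) (z : X) :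
    consFin x (snocFin y z) = snocFin (consFin x y) z := by
  funext i
  have := Finset.mem_Iic.1 i.2
  unfold consFin snocFin
  by_cases h0 : i.1 = 0
  · simp [h0]
  · by_cases h1 : i.1 ≤ n + 1
    · have : i.1 - 1 ≤ n := by omega
      simp [h0, h1]
    · have : ¬ i.1 - 1 ≤ n := by omega
      simp [h0, h1]

theorem frestrictLe_consSeq (x : X) (ω : ℕ → X) (n : ℕ) :
    Preorder.frestrictLe (π := fun _ => X) (n + 1) (consSeq x ω) =
      consFin x (Preorder.frestrictLe (π := fun _ => X) n ω) := by
  funext i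
  obtain ⟨i, hi⟩ := i
  cases i with
  | zero => rfl
  | succ i => rfl

variable [MeasurableSpace X]

theorem measurable_consSeq : Measurable fun p : X × (ℕ → X) => consSeq p.1 p.2 := by
  refine measurable_pi_lambda _ fun n => ?_
  cases n with
  | zero => exact measurable_fst
  | succ n => exact (measurable_pi_apply n).comp measurable_snd

theorem measurable_consSeq_right (x : X) : Measurable (consSeq x) :=
  measurable_consSeq.comp measurable_prodMk_left

theorem measurable_consFin (x : X) {n : ℕ} :
    Measurable (consFin x : (Finset.Iic n → X) → _) := by
  refine measurable_pi_lambda _ fun i => ?_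
  unfold consFin
  split_ifs
  · exact measurable_const
  · exact measurable_pi_apply _

theorem measurable_snocFin {n : ℕ} :
    Measurable fun p : (Finset.Iic n → X) × X => snocFin p.1 p.2 := by
  refine measurable_pi_lambda _ fun i => ?_
  unfold snocFin
  split_ifs
  · exact (measurable_pi_apply _).comp measurable_fst
  · exact measurable_snd

variable (K : (n : ℕ) → Kernel (Finset.Iic n → X) X) [∀ n, IsMarkovKernel (K n)]

theorem partialTraj_succ_self_apply (n : ℕ) (y : Finset.Iic n → X) :
    Kernel.partialTraj (X := fun _ => X) K n (n + 1) y = (K n y).map (snocFin y) := by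
  have hI : Measurable (IicProdIoc (X := fun _ => X) n (n + 1)) := measurable_IicProdIoc
  have hs := (MeasurableEquiv.piSingleton (X := fun _ => X) n).measurable
  rw [Kernel.partialTraj_succ_self, Kernel.map_apply _ hI, Kernel.prod_apply,
    Kernel.id_apply, Measure.dirac_prod, Kernel.map_apply _ hs,
    Measure.map_map measurable_prodMk_left hs,
    Measure.map_map hI (measurable_prodMk_left.comp hs)]
  congr 1
  funext z i
  change IicProdIoc (X := fun _ => X) n (n + 1)
    (y, MeasurableEquiv.piSingleton (X := fun _ => X) n z) i = _
  unfold IicProdIoc snocFin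
  split_ifs with h
  · rfl
  · have := Finset.mem_Iic.1 i.2
    obtain ⟨i, hi⟩ := i
    obtain rfl : i = n + 1 := by simp at *; omega
    rfl

theorem measure_ext_frestrictLe {μ ν : Measure (ℕ → X)} [IsFiniteMeasure μ] [IsFiniteMeasure ν]
    (h : ∀ n, μ.map (Preorder.frestrictLe (π := fun _ => X) (n + 1)) =
      ν.map (Preorder.frestrictLe (π := fun _ => X) (n + 1))) : μ = ν := by
  have hP : IsProjectiveMeasureFamily fun I : Finset ℕ => μ.map I.restrict := by
    intro I J hJI
    rw [Measure.map_map (Finset.measurable_restrict₂ (X := fun _ => X) hJI)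
      (Finset.measurable_restrict (X := fun _ => X) I)]
    rfl
  refine IsProjectiveLimit.unique (P := fun I : Finset ℕ => μ.map I.restrict) (fun I => rfl)
    ((isProjectiveLimit_nat_iff' hP ν 1).2 fun n hn => ?_)
  obtain ⟨n, rfl⟩ : ∃ m, n = m + 1 := ⟨n - 1, by omega⟩
  exact (h n).symm

variable (κ : Kernel X X)

theorem partialTraj_homogeneous_succ
    (hK : ∀ n y, K n y = κ (y ⟨n, Finset.mem_Iic.2 le_rfl⟩)) (n : ℕ) (x : X) :
    Kernel.partialTraj (X := fun _ => X) K 0 (n + 1) (fun _ => x) =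
      (κ x).bind fun x' =>
        (Kernel.partialTraj (X := fun _ => X) K 0 n (fun _ => x')).map (consFin x) := by
  have hc : Measurable fun x' : X => fun _ : Finset.Iic 0 => x' :=
    measurable_pi_lambda _ fun _ => measurable_id
  have hmeas (n : ℕ) : Measurable fun x' : X =>
        (Kernel.partialTraj (X := fun _ => X) K 0 n (fun _ => x')).map (consFin x) :=
    (Measure.measurable_map _ (measurable_consFin x)).comp
      ((Kernel.partialTraj (X := fun _ => X) K 0 n).measurable.comp hc)
  induction n with
  | zero =>
    rw [partialTraj_succ_self_apply, hK]
    have h1 : ∀ x' : X, (Kernel.partialTraj (X := fun _ => X) K 0 0 (fun _ => x')).map (consFin x) =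
        Measure.dirac (consFin x fun _ => x') := by
      intro x'
      rw [Kernel.partialTraj_self, Kernel.id_apply, Measure.map_dirac' (measurable_consFin x)]
    simp only [h1]
    have h2 : Measurable fun x' : X => consFin (n := 0) x fun _ => x' :=
      (measurable_consFin x).comp hc
    have h3 : (fun x' : X => consFin (n := 0) x fun _ => x') = snocFin fun _ => x := by
      funext x' i
      have := Finset.mem_Iic.1 i.2
      unfold consFin snocFin
      by_cases h : i.1 = 0 <;> simp [h]
    rw [← h3, Measure.bind_dirac_eq_map _ h2]
  | succ n ih =>
    have hs (n : ℕ) (y : Finset.Iic n → X) : Measurable (snocFin y) :=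
      measurable_snocFin.comp measurable_prodMk_left
    rw [Kernel.partialTraj_succ_eq_comp (Nat.zero_le _), Kernel.comp_apply, ih,
      Measure.bind_bind (hmeas n).aemeasurable (Kernel.aemeasurable _)]
    congr 1
    funext x'
    ext A hA
    rw [Kernel.partialTraj_succ_eq_comp (Nat.zero_le _), Kernel.comp_apply,
      Measure.bind_apply hA (Kernel.aemeasurable _),
      lintegral_map ((Kernel.measurable_coe _ hA)) (measurable_consFin x),
      Measure.map_apply (measurable_consFin x) hA,
      Measure.bind_apply (measurable_consFin x hA) (Kernel.aemeasurable _)]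
    refine lintegral_congr fun y => ?_
    rw [partialTraj_succ_self_apply, partialTraj_succ_self_apply, hK, hK,
      Measure.map_apply (hs _ _) hA, Measure.map_apply (hs _ _) (measurable_consFin x hA)]
    have h4 : consFin x y ⟨n + 1, Finset.mem_Iic.2 le_rfl⟩ = y ⟨n, Finset.mem_Iic.2 le_rfl⟩ := by
      simp [consFin]
    rw [h4]
    congr 1
    ext z
    simp only [mem_preimage, consFin_snocFin]

/-- The Markov property at the first step of a homogeneous chain. -/
theorem traj_homogeneous [IsMarkovKernel κ] (hK : ∀ n y, K n y = κ (y ⟨n, Finset.mem_Iic.2 le_rfl⟩)) (x : X) :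
    Kernel.traj (X := fun _ => X) K 0 (fun _ => x) =
      (κ x).bind fun x' =>
        (Kernel.traj (X := fun _ => X) K 0 (fun _ => x')).map (consSeq x) := by
  have hc : Measurable fun x' : X => fun _ : Finset.Iic 0 => x' :=
    measurable_pi_lambda _ fun _ => measurable_id
  have hm : Measurable fun x' : X =>
      (Kernel.traj (X := fun _ => X) K 0 (fun _ => x')).map (consSeq x) :=
    (Measure.measurable_map _ (measurable_consSeq_right x)).comp
      ((Kernel.traj (X := fun _ => X) K 0).measurable.comp hc)
  have hf (n : ℕ) : Measurable (Preorder.frestrictLe (π := fun _ : ℕ => X) n) :=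
    Preorder.measurable_frestrictLe n
  have hp : IsProbabilityMeasure ((κ x).bind fun x' =>
      (Kernel.traj (X := fun _ => X) K 0 (fun _ => x')).map (consSeq x)) := by
    refine isProbabilityMeasure_bind hm.aemeasurable (Eventually.of_forall fun x' => ?_)
    exact Measure.isProbabilityMeasure_map (measurable_consSeq_right x).aemeasurable
  refine measure_ext_frestrictLe fun n => ?_
  rw [Kernel.traj_map_frestrictLe_apply, partialTraj_homogeneous_succ K κ hK]
  ext A hA
  rw [Measure.map_apply (hf _) hA, Measure.bind_apply hA, Measure.bind_apply (hf _ hA)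
    hm.aemeasurable]
  · refine lintegral_congr fun x' => ?_
    rw [← Kernel.traj_map_frestrictLe_apply,
      Measure.map_map (measurable_consFin x) (hf n), Measure.map_apply
      ((measurable_consFin x).comp (hf n)) hA,
      Measure.map_apply (measurable_consSeq_right x) (hf _ hA)]
    congr 1
    ext ω
    simp only [mem_preimage, Function.comp, frestrictLe_consSeq]
  · exact ((Measure.measurable_map _ (measurable_consFin x)).comp
      ((Kernel.partialTraj (X := fun _ => X) K 0 n).measurable.comp hc)).aemeasurable

end MarkovChain

/-! ### Measurability in disjoint unions -/

section SigmaType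

variable {ι : Type*} {β : ι → Type*} [∀ i, MeasurableSpace (β i)]

theorem measurableSet_sigma_iff {A : Set (Σ i, β i)} :
    MeasurableSet A ↔ ∀ i, MeasurableSet (Sigma.mk i ⁻¹' A) :=
  MeasurableSpace.measurableSet_iInf

theorem measurable_sigmaMk (i : ι) : Measurable (Sigma.mk i : β i → Σ i, β i) :=
  fun _ hA => measurableSet_sigma_iff.1 hA i

theorem measurable_sigma_iff {Y : Type*} [MeasurableSpace Y] {f : (Σ i, β i) → Y} :
    Measurable f ↔ ∀ i, Measurable fun x : β i => f ⟨i, x⟩ :=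
  ⟨fun h i => h.comp (measurable_sigmaMk i),
    fun h _ hA => measurableSet_sigma_iff.2 fun i => h i hA⟩

theorem measurableEmbedding_sigmaMk (i : ι) :
    MeasurableEmbedding (Sigma.mk i : β i → Σ i, β i) := by
  refine ⟨sigma_mk_injective, measurable_sigmaMk i, fun {A} hA => ?_⟩
  refine measurableSet_sigma_iff.2 fun j => ?_
  by_cases h : i = j
  · subst h
    rwa [preimage_image_eq _ sigma_mk_injective]
  · convert! MeasurableSet.empty
    ext x
    simp only [mem_preimage, mem_image, mem_empty_iff_false, iff_false]
    rintro ⟨y, -, hy⟩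
    exact h (congrArg Sigma.fst hy)

theorem measurable_sigma_prod [Countable ι] {Y Z : Type*} [MeasurableSpace Y] [MeasurableSpace Z]
    {f : (Σ i, β i) × Y → Z} (hf : ∀ i, Measurable fun p : β i × Y => f (⟨i, p.1⟩, p.2)) :
    Measurable f := by
  intro A hA
  have h : f ⁻¹' A = ⋃ i, (Prod.map (Sigma.mk i) id : β i × Y → (Σ i, β i) × Y) ''
      ((fun p : β i × Y => f (⟨i, p.1⟩, p.2)) ⁻¹' A) := by
    ext ⟨⟨i, x⟩, y⟩
    simp only [mem_preimage, mem_iUnion, mem_image, Prod.exists, Prod.map, id]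
    constructor
    · exact fun h => ⟨i, x, y, h, rfl⟩
    · rintro ⟨j, x', y', h, he⟩
      rwa [← he]
  rw [h]
  exact MeasurableSet.iUnion fun i =>
    ((measurableEmbedding_sigmaMk i).prodMap MeasurableEmbedding.id).measurableSet_image' (hf i hA)

theorem standardBorelSpace_sigma [Countable ι] [∀ i, TopologicalSpace (β i)]
    [∀ i, BorelSpace (β i)] [∀ i, PolishSpace (β i)] : StandardBorelSpace (Σ i, β i) := by
  have : BorelSpace (Σ i, β i) := by
    refine ⟨le_antisymm (fun A hA => ?_) ?_⟩
    · have h : A = ⋃ i, Sigma.mk i '' (Sigma.mk i ⁻¹' A) := by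
        ext ⟨i, x⟩
        simp only [mem_iUnion, mem_image, mem_preimage]
        constructor
        · exact fun h => ⟨i, x, h, rfl⟩
        · rintro ⟨j, y, h, he⟩
          rwa [← he]
      rw [h]
      borelize (Σ i, β i)
      refine MeasurableSet.iUnion fun i => ?_
      exact (Topology.IsOpenEmbedding.sigmaMk.measurableEmbedding).measurableSet_image'
        (measurableSet_sigma_iff.1 hA i)
    · refine MeasurableSpace.generateFrom_le fun U hU => measurableSet_sigma_iff.2 fun i => ?_
      exact (hU.preimage continuous_sigmaMk).measurableSet
  infer_instance

end SigmaType

namespace GSMP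

variable {S E AP : Type*} [Fintype S] {P : GSMP S E AP}

instance : StandardBorelSpace P.Config := standardBorelSpace_sigma

theorem measurable_holdTime' : Measurable P.holdTime :=
  measurable_sigma_iff.2 measurable_holdTime

theorem measurable_evolve : Measurable fun p : P.Config × ℝ => P.evolve p.1 p.2 := by
  refine measurable_sigma_prod fun s => ?_
  have : Measurable fun p : (P.events s → ℝ) × ℝ => fun i => p.1 i - P.rate s i * p.2 :=
    measurable_pi_lambda _ fun i => ((measurable_pi_apply i).comp measurable_fst).sub
      (measurable_snd.const_mul _)
  exact (measurable_sigma_mk s).comp this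

theorem measurableSet_hasUniqueFirst : MeasurableSet {g : P.Config | P.HasUniqueFirst g} := by
  refine measurableSet_sigma_iff.2 fun s => ?_
  have h : Sigma.mk s ⁻¹' {g : P.Config | P.HasUniqueFirst g} =
      (⋂ i, {c : P.events s → ℝ | 0 < c i}) ∩ ⋃ i : P.events s, {c | P.IsFirst ⟨s, c⟩ i} := by
    ext c
    simp [HasUniqueFirst]
  rw [h]
  exact (MeasurableSet.iInter fun i => measurableSet_lt measurable_const (measurable_pi_apply i)).inter
    (MeasurableSet.iUnion fun i => measurableSet_isFirst s i)

theorem measurableSet_regular (n : ℕ) : MeasurableSet {g : P.Config | P.Regular n g} := by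
  induction n with
  | zero => exact measurableSet_hasUniqueFirst
  | succ n ih =>
    have h : {g : P.Config | P.Regular (n + 1) g} = {g | P.HasUniqueFirst g} ∩
        {g | P.jump g {g' | P.Regular n g'}ᶜ = 0} := by
      ext g
      rfl
    rw [h]
    exact measurableSet_hasUniqueFirst.inter
      ((Measure.measurable_coe ih.compl).comp measurable_jump (measurableSet_singleton 0))

theorem measurableSet_isGeneralized : MeasurableSet {g : P.Config | P.IsGeneralized g} := by
  have h : {g : P.Config | P.IsGeneralized g} = ⋂ n, {g | P.Regular n g} := by
    ext g
    simp [IsGeneralized]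
  rw [h]
  exact MeasurableSet.iInter measurableSet_regular

theorem IsGeneralized.ae_jump {g : P.Config} (hg : P.IsGeneralized g) :
    ∀ᵐ g' ∂P.jump g, P.IsGeneralized g' :=
  ae_all_iff.2 fun n => (hg (n + 1)).2

theorem measurable_jumpTime (n : ℕ) : Measurable fun ω : ℕ → P.Config => P.jumpTime ω n :=
  Finset.measurable_sum _ fun k _ => measurable_holdTime'.comp (measurable_pi_apply k)

theorem measurableSet_fvSeq : MeasurableSet {ω : ℕ → P.Config |
    (∀ n, P.IsGeneralized (ω n)) ∧ Tendsto (P.jumpTime ω) atTop atTop} := by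
  refine MeasurableSet.inter ?_ ?_
  · have : {ω : ℕ → P.Config | ∀ n, P.IsGeneralized (ω n)} =
        ⋂ n, (fun ω => ω n) ⁻¹' {g | P.IsGeneralized g} := by
      ext ω
      simp
    change MeasurableSet {ω : ℕ → P.Config | ∀ n, P.IsGeneralized (ω n)}
    rw [this]
    exact MeasurableSet.iInter fun n => measurable_pi_apply n measurableSet_isGeneralized
  · exact measurableSet_tendsto atTop measurable_jumpTime

instance : StandardBorelSpace P.FVSeq := measurableSet_fvSeq.standardBorel

/-! ### The Markov property of runs -/

theorem runLaw_eq (g : P.Config) :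
    P.runLaw g = (P.jump g).bind fun g' => (P.runLaw g').map (consSeq g) := by
  have : IsMarkovKernel (⟨P.jump, measurable_jump⟩ : Kernel P.Config P.Config) :=
    ⟨fun g => isProbabilityMeasure_jump g⟩
  exact traj_homogeneous P.jumpKernel ⟨P.jump, measurable_jump⟩ (fun _ _ => rfl) g

instance (g : P.Config) : IsProbabilityMeasure (P.runLaw g) := by
  unfold runLaw
  infer_instance

theorem measurable_runLaw : Measurable P.runLaw :=
  (Kernel.traj (X := fun _ => P.Config) P.jumpKernel 0).measurable.comp
    (measurable_pi_lambda _ fun _ => measurable_id)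

theorem measurable_map_consSeq (g : P.Config) :
    Measurable fun g' => (P.runLaw g').map (consSeq g) :=
  (Measure.measurable_map _ (measurable_consSeq_right g)).comp measurable_runLaw

theorem lintegral_runLaw (g : P.Config) {f : (ℕ → P.Config) → ℝ≥0∞} (hf : Measurable f) :
    ∫⁻ ω, f ω ∂P.runLaw g = ∫⁻ g', ∫⁻ ω, f (consSeq g ω) ∂P.runLaw g' ∂P.jump g := by
  rw [runLaw_eq, Measure.lintegral_bind (measurable_map_consSeq g).aemeasurable hf.aemeasurable]
  refine lintegral_congr fun g' => ?_
  rw [lintegral_map hf (measurable_consSeq_right g)]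

theorem ae_runLaw_iff (g : P.Config) {p : (ℕ → P.Config) → Prop} (hp : MeasurableSet {ω | p ω}) :
    (∀ᵐ ω ∂P.runLaw g, p ω) ↔ ∀ᵐ g' ∂P.jump g, ∀ᵐ ω ∂P.runLaw g', p (consSeq g ω) := by
  have h : {ω | ¬ p ω} = {ω | p ω}ᶜ := rfl
  have hm : Measurable fun g' => (P.runLaw g').map (consSeq g) {ω | p ω}ᶜ :=
    (Measure.measurable_coe hp.compl).comp (measurable_map_consSeq g)
  rw [ae_iff, h, runLaw_eq, Measure.bind_apply hp.compl (measurable_map_consSeq g).aemeasurable,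
    lintegral_eq_zero_iff hm]
  refine eventually_congr (Eventually.of_forall fun g' => ?_)
  change (P.runLaw g').map (consSeq g) {ω | p ω}ᶜ = 0 ↔ _
  rw [Measure.map_apply (measurable_consSeq_right g) hp.compl, ae_iff]
  rfl

theorem ae_runLaw_zero (g : P.Config) : ∀ᵐ ω ∂P.runLaw g, ω 0 = g := by
  have h : MeasurableSet {ω : ℕ → P.Config | ω 0 = g} :=
    (measurable_pi_apply 0 : Measurable fun ω : ℕ → P.Config => ω 0) (measurableSet_singleton g)
  rw [ae_runLaw_iff g h]
  exact Eventually.of_forall fun _ => Eventually.of_forall fun _ => rfl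

theorem IsGeneralized.ae_runLaw {g : P.Config} (hg : P.IsGeneralized g) :
    ∀ᵐ ω ∂P.runLaw g, ∀ n, P.IsGeneralized (ω n) := by
  refine ae_all_iff.2 fun n => ?_
  induction n generalizing g with
  | zero => exact (ae_runLaw_zero g).mono fun ω h => h ▸ hg
  | succ n ih =>
    have h : MeasurableSet {ω : ℕ → P.Config | P.IsGeneralized (ω (n + 1))} :=
      (measurable_pi_apply (n + 1) : Measurable fun ω : ℕ → P.Config => ω (n + 1))
        measurableSet_isGeneralized
    rw [ae_runLaw_iff g h]
    exact hg.ae_jump.mono fun g' hg' => ih hg'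

theorem runLaw_evolve {g : P.Config} (hg : ∃ i, P.IsFirst g i) (t : ℝ) :
    P.runLaw (P.evolve g t) = (P.runLaw g).map fun ω => Function.update ω 0 (P.evolve g t) := by
  have hu : Measurable fun ω : ℕ → P.Config => Function.update ω 0 (P.evolve g t) :=
    measurable_update_left
  ext A hA
  rw [Measure.map_apply hu hA, runLaw_eq, runLaw_eq g, jump_evolve hg,
    Measure.bind_apply hA (measurable_map_consSeq _).aemeasurable,
    Measure.bind_apply (hu hA) (measurable_map_consSeq _).aemeasurable]
  refine lintegral_congr fun g' => ?_
  rw [Measure.map_apply (measurable_consSeq_right _) hA,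
    Measure.map_apply (measurable_consSeq_right _) (hu hA)]
  congr 1
  ext ω
  have : consSeq (P.evolve g t) ω = Function.update (consSeq g ω) 0 (P.evolve g t) := by
    funext n
    cases n <;> simp [consSeq]
  simp only [mem_preimage, this]

end GSMP

theorem lintegral_le_of_le_on {Z : Type*} [MeasurableSpace Z] {μ : Measure Z}
    [IsProbabilityMeasure μ] {f : Z → ℝ≥0∞} {A : Set Z} (hA : MeasurableSet A) {p q : ℝ≥0∞}
    (hq : q ≤ 1) (hp : p ≤ μ A) (hf : ∀ᵐ z ∂μ, f z ≤ 1) (hfA : ∀ᵐ z ∂μ, z ∈ A → f z ≤ q) :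
    ∫⁻ z, f z ∂μ ≤ q * p + (1 - p) := by
  have h1 : ∫⁻ z, f z ∂μ ≤ ∫⁻ z, (A.indicator (fun _ => q) z + Aᶜ.indicator (fun _ => 1) z) ∂μ := by
    refine lintegral_mono_ae ?_
    filter_upwards [hf, hfA] with z h1 h2
    by_cases hz : z ∈ A
    · simpa [hz] using h2 hz
    · simpa [hz] using h1
  have h2 : ∫⁻ z, (A.indicator (fun _ => q) z + Aᶜ.indicator (fun _ => 1) z) ∂μ =
      q * μ A + μ Aᶜ := by
    rw [lintegral_add_left (measurable_const.indicator hA), lintegral_indicator_const hA,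
      lintegral_indicator_const hA.compl, one_mul]
  have h3 : μ Aᶜ = 1 - μ A := prob_compl_eq_one_sub hA
  have h4 : μ A = p + (μ A - p) := (add_tsub_cancel_of_le hp).symm
  have h5 : (μ A - p) + (1 - μ A) = 1 - p := by
    rw [add_comm]
    exact tsub_add_tsub_cancel prob_le_one hp
  calc ∫⁻ z, f z ∂μ ≤ q * μ A + μ Aᶜ := h1.trans_eq h2
    _ = q * p + (q * (μ A - p) + (1 - μ A)) := by
        rw [h3]
        nth_rewrite 1 [h4]
        rw [mul_add, add_assoc]
    _ ≤ q * p + (1 * (μ A - p) + (1 - μ A)) := by gcongr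
    _ = q * p + (1 - p) := by rw [one_mul, h5]

theorem ENNReal.mul_add_one_sub_lt_one {p q : ℝ≥0∞} (hq : q < 1) (hp0 : p ≠ 0) (hp1 : p ≤ 1) :
    q * p + (1 - p) < 1 := by
  have hpt : p ≠ ∞ := (hp1.trans_lt ENNReal.one_lt_top).ne
  have h1 : q * p < p := by
    simpa using (ENNReal.mul_lt_mul_iff_left hp0 hpt).2 hq
  calc q * p + (1 - p) < p + (1 - p) :=
        ENNReal.add_lt_add_right (ENNReal.sub_ne_top ENNReal.one_ne_top) h1
    _ = 1 := add_tsub_cancel_of_le hp1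

namespace GSMP

variable {S E AP : Type*} [Fintype S] {P : GSMP S E AP}

theorem HasUniqueFirst.holdTime_pos {g : P.Config} (hg : P.HasUniqueFirst g) :
    0 < P.holdTime g := by
  obtain ⟨i, hi⟩ := hg.2
  rw [hi.holdTime_eq]
  exact div_pos (hg.1 i) (P.rate_pos _ i)

theorem jumpTime_succ (ω : ℕ → P.Config) (n : ℕ) :
    P.jumpTime ω (n + 1) = P.jumpTime ω n + P.holdTime (ω n) :=
  Finset.sum_range_succ _ _

theorem jumpTime_consSeq (g : P.Config) (ω : ℕ → P.Config) (n : ℕ) :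
    P.jumpTime (consSeq g ω) (n + 1) = P.holdTime g + P.jumpTime ω n := by
  unfold jumpTime
  rw [Finset.sum_range_succ', add_comm]
  rfl

/-! ### Runs are almost surely non-Zeno -/

/-- The expectation of `exp (-t)` for the time `t` of the `n`-th jump. -/
noncomputable def discount (n : ℕ) (g : P.Config) : ℝ≥0∞ :=
  ∫⁻ ω, ENNReal.ofReal (Real.exp (-P.jumpTime ω n)) ∂P.runLaw g

theorem measurable_exp_jumpTime (n : ℕ) :
    Measurable fun ω : ℕ → P.Config => ENNReal.ofReal (Real.exp (-P.jumpTime ω n)) :=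
  (measurable_jumpTime n).neg.exp.ennreal_ofReal

theorem measurable_discount (n : ℕ) : Measurable (discount n : P.Config → ℝ≥0∞) :=
  (Measure.measurable_lintegral (measurable_exp_jumpTime n)).comp measurable_runLaw

theorem discount_zero (g : P.Config) : discount 0 g = 1 := by
  simp [discount, jumpTime]

theorem discount_succ (n : ℕ) (g : P.Config) :
    discount (n + 1) g =
      ENNReal.ofReal (Real.exp (-P.holdTime g)) * ∫⁻ g', discount n g' ∂P.jump g := by
  rw [discount, lintegral_runLaw g (measurable_exp_jumpTime _),
    ← lintegral_const_mul _ (measurable_discount n)]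
  refine lintegral_congr fun g' => ?_
  rw [discount, ← lintegral_const_mul _ (measurable_exp_jumpTime n)]
  refine lintegral_congr fun ω => ?_
  rw [jumpTime_consSeq, neg_add, Real.exp_add, ENNReal.ofReal_mul (Real.exp_nonneg _)]

theorem IsGeneralized.ofReal_exp_le_one {g : P.Config} (hg : P.IsGeneralized g) :
    ENNReal.ofReal (Real.exp (-P.holdTime g)) ≤ 1 := by
  rw [ENNReal.ofReal_le_one, Real.exp_le_one_iff]
  linarith [hg.hasUniqueFirst.holdTime_pos]

theorem IsGeneralized.discount_le_one {g : P.Config} (hg : P.IsGeneralized g) (n : ℕ) :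
    discount n g ≤ 1 := by
  induction n generalizing g with
  | zero => exact (discount_zero g).le
  | succ n ih =>
    rw [discount_succ]
    refine mul_le_one' hg.ofReal_exp_le_one ?_
    calc ∫⁻ g', discount n g' ∂P.jump g ≤ ∫⁻ _, 1 ∂P.jump g :=
          lintegral_mono_ae (hg.ae_jump.mono fun g' hg' => ih hg')
      _ = 1 := by simp

theorem IsGeneralized.discount_succ_le {g : P.Config} (hg : P.IsGeneralized g) (n : ℕ) :
    discount (n + 1) g ≤ ENNReal.ofReal (Real.exp (-P.holdTime g)) := by
  rw [discount_succ]
  refine mul_le_of_le_one_right' ?_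
  calc ∫⁻ g', discount n g' ∂P.jump g ≤ ∫⁻ _, 1 ∂P.jump g :=
        lintegral_mono_ae (hg.ae_jump.mono fun g' hg' => hg'.discount_le_one n)
    _ = 1 := by simp

theorem IsGeneralized.discount_add_le {C : ℝ≥0∞} {n : ℕ}
    (hC : ∀ g : P.Config, P.IsGeneralized g → discount n g ≤ C) {g : P.Config}
    (hg : P.IsGeneralized g) (m : ℕ) : discount (m + n) g ≤ C * discount m g := by
  induction m generalizing g with
  | zero => simpa [discount_zero] using hC g hg
  | succ m ih =>
    rw [Nat.add_right_comm, discount_succ, discount_succ, mul_left_comm,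
      ← lintegral_const_mul _ (measurable_discount m)]
    exact mul_le_mul' le_rfl (lintegral_mono_ae (hg.ae_jump.mono fun g' hg' => ih hg'))

theorem eventually_le_lifetime (s : S) (i : P.events s) (s' : S) (j : P.events s') :
    ∀ᶠ δ in 𝓝[>] (0 : ℝ), 2⁻¹ ≤ P.lifetime s i s' j (Ici δ) := by
  have h0 : P.lifetime s i s' j (Ioi 0) = 1 := by
    rw [lifetime, withDensity_apply _ measurableSet_Ioi, Measure.restrict_restrict measurableSet_Ioi,
      inter_self]
    exact P.density_lintegral s i s' j
  have hU : (⋃ n : ℕ, Ici (1 / ((n : ℝ) + 1))) = Ioi 0 := by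
    ext x
    simp only [mem_iUnion, mem_Ici, mem_Ioi]
    constructor
    · rintro ⟨n, hn⟩
      exact (Nat.one_div_pos_of_nat).trans_le hn
    · intro hx
      obtain ⟨n, hn⟩ := exists_nat_one_div_lt hx
      exact ⟨n, hn.le⟩
  have hmono : Monotone fun n : ℕ => Ici (1 / ((n : ℝ) + 1)) := by
    intro m n hmn
    exact Ici_subset_Ici.2 (Nat.one_div_le_one_div hmn)
  have ht := tendsto_measure_iUnion_atTop (μ := P.lifetime s i s' j) hmono
  rw [hU, h0] at ht
  obtain ⟨n, hn⟩ := (ht.eventually (lt_mem_nhds (by norm_num : (2⁻¹ : ℝ≥0∞) < 1))).exists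
  have : (0 : ℝ) < 1 / ((n : ℝ) + 1) := Nat.one_div_pos_of_nat
  filter_upwards [Ioo_mem_nhdsGT this] with δ hδ
  exact hn.le.trans (measure_mono (Ici_subset_Ici.2 hδ.2.le))

theorem exists_le_lifetime (P : GSMP S E AP) : ∃ δ : ℝ, 0 < δ ∧
    ∀ s i s' j, 2⁻¹ ≤ P.lifetime s i s' j (Ici δ) := by
  have h : ∀ᶠ δ in 𝓝[>] (0 : ℝ), ∀ s i s' j, 2⁻¹ ≤ P.lifetime s i s' j (Ici δ) :=
    eventually_all.2 fun s => eventually_all.2 fun i => eventually_all.2 fun s' =>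
      eventually_all.2 fun j => eventually_le_lifetime s i s' j
  obtain ⟨δ, h1, h2⟩ := (h.and self_mem_nhdsWithin).exists
  exact ⟨δ, h2, h1⟩

theorem exists_rate_le (P : GSMP S E AP) : ∃ R : ℝ, 0 < R ∧ ∀ s i, P.rate s i ≤ R := by
  have h : ∀ᶠ R in atTop, ∀ s i, P.rate s i ≤ R :=
    eventually_all.2 fun s => eventually_all.2 fun i => eventually_ge_atTop _
  obtain ⟨R, h1, h2⟩ := (h.and (eventually_gt_atTop 0)).exists
  exact ⟨R, h2, h1⟩

/-- The number of all events of all states. -/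
def numEvents (P : GSMP S E AP) : ℕ := ∑ s, (P.events s).card

theorem card_events_le (s : S) : (P.events s).card ≤ P.numEvents :=
  Finset.single_le_sum (f := fun s => (P.events s).card) (fun _ _ => Nat.zero_le _)
    (Finset.mem_univ s)

theorem pi_lifetime_ge {δ : ℝ} (hδ : ∀ s i s' j, 2⁻¹ ≤ P.lifetime s i s' j (Ici δ)) (s : S)
    (i : P.events s) (s' : S) :
    (2⁻¹ : ℝ≥0∞) ^ P.numEvents ≤ Measure.pi (P.lifetime s i s') (univ.pi fun _ => Ici δ) := by
  rw [Measure.pi_pi]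
  calc (2⁻¹ : ℝ≥0∞) ^ P.numEvents ≤ 2⁻¹ ^ (P.events s').card :=
        pow_le_pow_right_of_le_one' (by norm_num) (card_events_le s')
    _ = ∏ _j : P.events s', 2⁻¹ := by simp
    _ ≤ _ := Finset.prod_le_prod' fun j _ => hδ s i s' j

open Classical in
/-- The events whose clocks have values below `θ`. -/
noncomputable def lowEvents (θ : ℝ) (g : P.Config) : Finset E :=
  (Finset.univ.filter fun i : P.events g.1 => g.2 i < θ).image Subtype.val

theorem mem_lowEvents {θ : ℝ} {g : P.Config} {e : E} :
    e ∈ lowEvents θ g ↔ ∃ h : e ∈ P.events g.1, g.2 ⟨e, h⟩ < θ := by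
  simp [lowEvents]

theorem card_lowEvents_le (θ : ℝ) (g : P.Config) : (lowEvents θ g).card ≤ P.numEvents := by
  refine (Finset.card_le_card fun e he => ?_).trans (card_events_le g.1)
  exact (mem_lowEvents.1 he).1

theorem card_lowEvents_newClocks_lt {g : P.Config} (hg : P.HasUniqueFirst g) {i : P.events g.1}
    (hi : P.IsFirst g i) {R δ θ : ℝ} (hR0 : 0 < R) (hR : ∀ s i, P.rate s i ≤ R) (hθ : 0 < θ)
    (hθδ : θ ≤ δ) (hT : P.holdTime g < θ / (2 * R)) (s' : S) {z : P.events s' → ℝ}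
    (hz : ∀ j, δ ≤ z j) :
    (lowEvents (θ / 2) (⟨s', P.newClocks g i s' z⟩ : P.Config)).card < (lowEvents θ g).card := by
  classical
  have hT0 := hg.holdTime_pos
  have hrT (j : P.events g.1) : P.rate g.1 j * P.holdTime g < θ / 2 := by
    calc P.rate g.1 j * P.holdTime g ≤ R * P.holdTime g :=
          mul_le_mul_of_nonneg_right (hR _ _) hT0.le
      _ < R * (θ / (2 * R)) := mul_lt_mul_of_pos_left hT hR0
      _ = θ / 2 := by field_simp
  refine Finset.card_lt_card (Finset.ssubset_iff_of_subset (fun e he => ?_) |>.2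
    ⟨i.1, mem_lowEvents.2 ⟨i.2, ?_⟩, fun hmem => ?_⟩)
  · obtain ⟨h1, h2⟩ := mem_lowEvents.1 he
    by_cases h : e ∈ P.events g.1 ∧ e ≠ i.1
    · have h3 : P.newClocks g i s' z ⟨e, h1⟩ =
          g.2 ⟨e, h.1⟩ - P.rate g.1 ⟨e, h.1⟩ * P.holdTime g := dif_pos h
      refine mem_lowEvents.2 ⟨h.1, ?_⟩
      change P.newClocks g i s' z ⟨e, h1⟩ < θ / 2 at h2
      linarith [hrT ⟨e, h.1⟩]
    · have h3 : P.newClocks g i s' z ⟨e, h1⟩ = z ⟨e, h1⟩ := dif_neg h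
      change P.newClocks g i s' z ⟨e, h1⟩ < θ / 2 at h2
      linarith [hz ⟨e, h1⟩]
  · have h1 := hrT i
    rw [hi.holdTime_eq, mul_div_cancel₀ _ (P.rate_pos _ i).ne'] at h1
    change g.2 i < θ
    linarith
  · obtain ⟨h1, h2⟩ := mem_lowEvents.1 hmem
    have h3 : P.newClocks g i s' z ⟨i.1, h1⟩ = z ⟨i.1, h1⟩ := dif_neg (by simp)
    change P.newClocks g i s' z ⟨i.1, h1⟩ < θ / 2 at h2
    linarith [hz ⟨i.1, h1⟩]

theorem lintegral_jump {g : P.Config} {i : P.events g.1} (hi : P.IsFirst g i)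
    {f : P.Config → ℝ≥0∞} (hf : Measurable f) :
    ∫⁻ g', f g' ∂P.jump g = ∑ s', ENNReal.ofReal (P.next g.1 i s') *
      ∫⁻ z, f ⟨s', P.newClocks g i s' z⟩ ∂Measure.pi (P.lifetime g.1 i s') := by
  rw [jump_eq hi, jumpBy, lintegral_finsetSum_measure]
  refine Finset.sum_congr rfl fun s' _ => ?_
  rw [lintegral_smul_measure, lintegral_map hf (measurable_newConfig g i s'), smul_eq_mul]

theorem IsGeneralized.ae_newClocks {g : P.Config} (hg : P.IsGeneralized g) {i : P.events g.1}
    (hi : P.IsFirst g i) {s' : S} (hs' : ENNReal.ofReal (P.next g.1 i s') ≠ 0) :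
    ∀ᵐ z ∂Measure.pi (P.lifetime g.1 i s'),
      P.IsGeneralized (⟨s', P.newClocks g i s' z⟩ : P.Config) := by
  have h := hg.ae_jump
  rw [jump_eq hi, jumpBy, ae_iff, Measure.finsetSum_apply, Finset.sum_eq_zero_iff] at h
  have h1 := h s' (Finset.mem_univ _)
  rw [Measure.smul_apply, smul_eq_mul, mul_eq_zero, or_iff_right hs', ← ae_iff] at h1
  exact ae_of_ae_map (measurable_newConfig g i s').aemeasurable h1

theorem exists_discount_le {R δ : ℝ} (hR0 : 0 < R) (hR : ∀ s i, P.rate s i ≤ R)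
    (hδ : ∀ s i s' j, 2⁻¹ ≤ P.lifetime s i s' j (Ici δ)) (n : ℕ) {θ : ℝ} (hθ : 0 < θ)
    (hθδ : θ ≤ δ) : ∃ q : ℝ≥0∞, q < 1 ∧ ∀ g : P.Config, P.IsGeneralized g →
      (lowEvents θ g).card ≤ n → discount (n + 1) g ≤ q := by
  induction n generalizing θ with
  | zero =>
    refine ⟨ENNReal.ofReal (Real.exp (-(θ / R))), ?_, fun g hg hlow => ?_⟩
    · rw [ENNReal.ofReal_lt_one, Real.exp_lt_one_iff, neg_lt_zero]
      positivity
    · refine (hg.discount_succ_le 0).trans ?_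
      gcongr
      obtain ⟨i, hi⟩ := hg.hasUniqueFirst.2
      have h1 : θ ≤ g.2 i := by
        by_contra! h
        have h2 : i.1 ∈ lowEvents θ g := mem_lowEvents.2 ⟨i.2, h⟩
        simp [Finset.card_eq_zero.1 (Nat.le_zero.1 hlow)] at h2
      rw [hi.holdTime_eq]
      have := P.rate_pos g.1 i
      exact div_le_div₀ (hθ.le.trans h1) h1 this (hR _ _)
  | succ n ih =>
    obtain ⟨q, hq, hqg⟩ := ih (half_pos hθ) ((half_le_self hθ.le).trans hθδ)
    set p : ℝ≥0∞ := 2⁻¹ ^ P.numEvents with hp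
    have hp1 : p ≤ 1 := pow_le_one' (by norm_num) _
    have hp0 : p ≠ 0 := by simp [hp]
    refine ⟨max (ENNReal.ofReal (Real.exp (-(θ / (2 * R))))) (q * p + (1 - p)), max_lt ?_
      (ENNReal.mul_add_one_sub_lt_one hq hp0 hp1), fun g hg hlow => ?_⟩
    · rw [ENNReal.ofReal_lt_one, Real.exp_lt_one_iff, neg_lt_zero]
      positivity
    rcases le_or_gt (θ / (2 * R)) (P.holdTime g) with hT | hT
    · refine (hg.discount_succ_le _).trans (le_max_of_le_left ?_)
      gcongr
    · refine le_max_of_le_right ?_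
      obtain ⟨i, hi⟩ := hg.hasUniqueFirst.2
      rw [discount_succ, lintegral_jump hi (measurable_discount _)]
      refine mul_le_of_le_one_of_le hg.ofReal_exp_le_one ?_
      calc ∑ s', ENNReal.ofReal (P.next g.1 i s') * ∫⁻ z,
              discount (n + 1) (⟨s', P.newClocks g i s' z⟩ : P.Config)
                ∂Measure.pi (P.lifetime g.1 i s')
          ≤ ∑ s', ENNReal.ofReal (P.next g.1 i s') * (q * p + (1 - p)) := by
            refine Finset.sum_le_sum fun s' _ => ?_
            by_cases h0 : ENNReal.ofReal (P.next g.1 i s') = 0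
            · simp [h0]
            gcongr
            have hae := hg.ae_newClocks hi h0
            refine lintegral_le_of_le_on (MeasurableSet.univ_pi fun _ => measurableSet_Ici) hq.le
              (pi_lifetime_ge hδ g.1 i s') (hae.mono fun z hz => hz.discount_le_one _)
              (hae.mono fun z hz hzA => hqg _ hz ?_)
            have := card_lowEvents_newClocks_lt hg.hasUniqueFirst hi hR0 hR hθ hθδ hT s'
              (z := z) (fun j => hzA j (mem_univ j))
            omega
        _ = q * p + (1 - p) := by
            rw [← Finset.sum_mul, ← ENNReal.ofReal_sum_of_nonneg fun s' _ => P.next_nonneg g.1 i s',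
              P.next_sum, ENNReal.ofReal_one, one_mul]

theorem IsGeneralized.ae_tendsto_jumpTime {g : P.Config} (hg : P.IsGeneralized g) :
    ∀ᵐ ω ∂P.runLaw g, Tendsto (P.jumpTime ω) atTop atTop := by
  obtain ⟨δ, hδ0, hδ⟩ := P.exists_le_lifetime
  obtain ⟨R, hR0, hR⟩ := P.exists_rate_le
  obtain ⟨q, hq, hqg⟩ := exists_discount_le hR0 hR hδ P.numEvents hδ0 le_rfl
  have hpow (m : ℕ) : discount (m * (P.numEvents + 1)) g ≤ q ^ m := by
    induction m with
    | zero => simp [discount_zero]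
    | succ m ih =>
      rw [Nat.succ_mul, pow_succ']
      refine (hg.discount_add_le (fun g hg => hqg g hg (card_lowEvents_le _ _)) _).trans ?_
      gcongr
  have hK (K : ℕ) : ∀ᵐ ω ∂P.runLaw g, ∃ n, (K : ℝ) < P.jumpTime ω n := by
    rw [ae_iff]
    have h1 (m : ℕ) : ENNReal.ofReal (Real.exp (-(K : ℝ))) *
        P.runLaw g {ω | ¬ ∃ n, (K : ℝ) < P.jumpTime ω n} ≤ q ^ m := by
      refine le_trans ?_ (hpow m)
      refine le_trans ?_ (mul_meas_ge_le_lintegral (measurable_exp_jumpTime _)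
        (ENNReal.ofReal (Real.exp (-(K : ℝ)))))
      gcongr with ω
      intro h
      push Not at h
      exact ENNReal.ofReal_le_ofReal (Real.exp_le_exp.2 (neg_le_neg (h _)))
    have h2 := ge_of_tendsto' (ENNReal.tendsto_pow_atTop_nhds_zero_of_lt_one hq) h1
    have h3 : ENNReal.ofReal (Real.exp (-(K : ℝ))) ≠ 0 := by simp [Real.exp_pos]
    exact (mul_eq_zero.1 (le_antisymm h2 zero_le)).resolve_left h3
  filter_upwards [ae_all_iff.2 hK, hg.ae_runLaw] with ω h1 h2
  refine tendsto_atTop_atTop_of_monotone (monotone_nat_of_le_succ fun n => ?_) fun b => ?_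
  · rw [jumpTime_succ]
    linarith [(h2 n).hasUniqueFirst.holdTime_pos]
  · obtain ⟨K, hK⟩ := exists_nat_gt b
    obtain ⟨n, hn⟩ := h1 K
    exact ⟨n, (hK.trans hn).le⟩

/-! ### The law of the traces -/

theorem measurableEmbedding_fvSeq :
    MeasurableEmbedding (Subtype.val : P.FVSeq → ℕ → P.Config) :=
  MeasurableEmbedding.subtype_coe measurableSet_fvSeq

theorem map_tracesLaw (g : P.GState) : (P.tracesLaw g).map Subtype.val = P.runLaw g.1 := by
  rw [tracesLaw, measurableEmbedding_fvSeq.map_comap]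
  refine Measure.restrict_eq_self_of_ae_mem ?_
  filter_upwards [g.2.ae_runLaw, g.2.ae_tendsto_jumpTime] with ω h1 h2 using ⟨⟨ω, h1, h2⟩, rfl⟩

instance (g : P.GState) : IsProbabilityMeasure (P.tracesLaw g) := by
  have h : IsProbabilityMeasure ((P.tracesLaw g).map Subtype.val) := by
    rw [map_tracesLaw]
    infer_instance
  constructor
  have := h.measure_univ
  rwa [Measure.map_apply measurable_subtype_coe MeasurableSet.univ, preimage_univ] at this

theorem measurable_tracesLaw : Measurable P.tracesLaw := by
  refine Measure.measurable_of_measurable_coe _ fun A hA => ?_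
  have h : (fun g : P.GState => P.tracesLaw g A) = fun g => P.runLaw g.1 (Subtype.val '' A) := by
    funext g
    exact measurableEmbedding_fvSeq.comap_apply _ _
  rw [h]
  exact (Measure.measurable_coe (measurableEmbedding_fvSeq.measurableSet_image' hA)).comp
    (measurable_runLaw.comp measurable_subtype_coe)

end GSMP

theorem ciSup_le_ciSup_add {α β : Type*} [Nonempty α] {a : α → ℝ} {b : β → ℝ}
    (hb : BddAbove (range b)) {c : ℝ} (h : ∀ x, ∀ ε > 0, ∃ y, a x ≤ b y + c + ε) :
    ⨆ x, a x ≤ (⨆ y, b y) + c := by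
  refine ciSup_le fun x => le_of_forall_pos_le_add fun ε hε => ?_
  obtain ⟨y, hy⟩ := h x ε hε
  linarith [le_ciSup hb y]

theorem abs_integral_sub_integral_le {Z : Type*} [MeasurableSpace Z] {μ : Measure Z}
    [IsProbabilityMeasure μ] {a b : Z → ℝ} (ha : Integrable a μ) (hb : Integrable b μ) {c : ℝ}
    (h : ∀ᵐ z ∂μ, |a z - b z| ≤ c) : |∫ z, a z ∂μ - ∫ z, b z ∂μ| ≤ c := by
  rw [← integral_sub ha hb]
  have h' : ∀ᵐ z ∂μ, ‖a z - b z‖ ≤ c := h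
  simpa using norm_integral_le_of_norm_le_const h'

theorem integrable_of_mem_Icc {Z : Type*} [MeasurableSpace Z] {μ : Measure Z}
    [IsFiniteMeasure μ] {a : Z → ℝ} (ha : Measurable a) (h : ∀ z, a z ∈ Icc (0 : ℝ) 1) :
    Integrable a μ :=
  Integrable.of_mem_Icc 0 1 ha.aemeasurable (Eventually.of_forall h)

theorem integral_mem_Icc {Z : Type*} [MeasurableSpace Z] {μ : Measure Z}
    [IsProbabilityMeasure μ] {a : Z → ℝ} (ha : Measurable a) (h : ∀ z, a z ∈ Icc (0 : ℝ) 1) :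
    ∫ z, a z ∂μ ∈ Icc (0 : ℝ) 1 := by
  refine ⟨integral_nonneg fun z => (h z).1, ?_⟩
  calc ∫ z, a z ∂μ ≤ ∫ _, 1 ∂μ :=
        integral_mono (integrable_of_mem_Icc ha h) (integrable_const _) fun z => (h z).2
    _ = 1 := by simp

theorem abs_min_sub_min_le {a b c d e : ℝ} (h1 : |a - c| ≤ e) (h2 : |b - d| ≤ e) :
    |min a b - min c d| ≤ e :=
  (abs_min_sub_min_le_max a b c d).trans (max_le h1 h2)

namespace GSMP

theorem IsUnitLipschitz.continuousOn {h : ℝ → ℝ} (hh : IsUnitLipschitz h) :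
    ContinuousOn h (Icc 0 1) :=
  (LipschitzOnWith.of_dist_le_mul (K := 1) fun x hx y hy => by
    simpa [Real.dist_eq] using hh.2 x hx y hy).continuousOn

theorem IsUnitLipschitz.measurable_comp {Z : Type*} [MeasurableSpace Z] {h : ℝ → ℝ}
    (hh : IsUnitLipschitz h) {a : Z → ℝ} (ha : Measurable a) (h1 : ∀ z, a z ∈ Icc (0 : ℝ) 1) :
    Measurable fun z => h (a z) := by
  have h2 : Measurable ((Icc (0 : ℝ) 1).domRestrict h) :=
    (continuousOn_iff_continuous_domRestrict.1 hh.continuousOn).measurable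
  exact h2.comp (ha.subtype_mk (h := h1))

variable {S E AP : Type*} [Fintype S] {P : GSMP S E AP}

theorem evolve_evolve (g : P.Config) (s t : ℝ) :
    P.evolve (P.evolve g s) t = P.evolve g (s + t) := by
  unfold evolve
  congr 1
  funext i
  ring

theorem IsGeneralized.holdTime_evolve {g : P.Config} (hg : P.IsGeneralized g) (t : ℝ) :
    P.holdTime (P.evolve g t) = P.holdTime g - t := by
  obtain ⟨i, hi⟩ := hg.hasUniqueFirst.2
  rw [hi.holdTime_eq, (hi.evolve t).holdTime_eq]
  exact evolve_div g t i

/-! ### Traces of finitely varying sequences -/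

namespace FVSeq

theorem holdTime_pos (ω : P.FVSeq) (n : ℕ) : 0 < P.holdTime (ω.1 n) :=
  (ω.2.1 n).hasUniqueFirst.holdTime_pos

theorem strictMono_jumpTime (ω : P.FVSeq) : StrictMono (P.jumpTime ω.1) :=
  strictMono_nat_of_lt_succ fun n => by
    rw [jumpTime_succ]
    linarith [ω.holdTime_pos n]

theorem index_eq_iff {ω : P.FVSeq} {t : ℝ≥0} {n : ℕ} :
    ω.index t = n ↔ P.jumpTime ω.1 n ≤ t ∧ (t : ℝ) < P.jumpTime ω.1 (n + 1) := by
  constructor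
  · rintro rfl
    exact ⟨ω.jumpTime_le t, ω.lt_jumpTime t⟩
  · rintro ⟨h1, h2⟩
    have h3 := ω.strictMono_jumpTime.lt_iff_lt.1 ((ω.jumpTime_le t).trans_lt h2)
    have h4 := ω.strictMono_jumpTime.lt_iff_lt.1 (h1.trans_lt (ω.lt_jumpTime t))
    omega

theorem index_mono (ω : P.FVSeq) : Monotone ω.index := by
  intro s t hst
  have h1 : (s : ℝ) ≤ t := hst
  have := ω.strictMono_jumpTime.lt_iff_lt.1
    ((ω.jumpTime_le s).trans_lt (h1.trans_lt (ω.lt_jumpTime t)))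
  omega

theorem coe_trace_of_index_eq {ω : P.FVSeq} {t : ℝ≥0} {n : ℕ} (h : ω.index t = n) :
    (ω.trace t).1 = P.evolve (ω.1 n) (t - P.jumpTime ω.1 n) := by
  subst h
  rfl

theorem trace_eq_evolve_trace {ω : P.FVSeq} {s t : ℝ≥0} (h : ω.index s = ω.index t) :
    (ω.trace t).1 = P.evolve (ω.trace s).1 (t - s) := by
  rw [coe_trace_of_index_eq h, coe_trace_of_index_eq rfl, evolve_evolve]
  congr 1
  ring

theorem sub_lt_holdTime_trace {ω : P.FVSeq} {s t : ℝ≥0} (h : ω.index s = ω.index t) :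
    (t - s : ℝ) < P.holdTime (ω.trace s).1 := by
  rw [coe_trace_of_index_eq h, (ω.2.1 _).holdTime_evolve]
  have := ω.lt_jumpTime t
  rw [jumpTime_succ] at this
  linarith

theorem exists_gt_index_eq (ω : P.FVSeq) (t : ℝ≥0) :
    ∃ u, t < u ∧ ∀ s, t ≤ s → s < u → ω.index s = ω.index t := by
  refine ⟨Real.toNNReal (P.jumpTime ω.1 (ω.index t + 1)), ?_, fun s h1 h2 => ?_⟩
  · rw [Real.lt_toNNReal_iff_coe_lt]
    exact ω.lt_jumpTime t
  · rw [Real.lt_toNNReal_iff_coe_lt] at h2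
    exact index_eq_iff.2 ⟨(ω.jumpTime_le t).trans h1, h2⟩

/-- Start a finitely varying sequence a little later, before its first jump. -/
noncomputable def shift (ω : P.FVSeq) (s : ℝ≥0) (hs : (s : ℝ) < P.holdTime (ω.1 0)) : P.FVSeq :=
  ⟨Function.update ω.1 0 (P.evolve (ω.1 0) s), by
    refine ⟨fun n => ?_, ?_⟩
    · cases n with
      | zero => simpa using (ω.2.1 0).evolve hs
      | succ n => simpa using ω.2.1 (n + 1)
    · have h : ∀ n, P.jumpTime (Function.update ω.1 0 (P.evolve (ω.1 0) s)) (n + 1) =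
          P.jumpTime ω.1 (n + 1) - s := by
        intro n
        simp only [jumpTime, Finset.sum_range_succ', Function.update_self,
          (ω.2.1 0).holdTime_evolve]
        simp
        ring
      rw [← tendsto_add_atTop_iff_nat 1]
      simp only [h]
      exact tendsto_atTop_add_const_right _ _ ((tendsto_add_atTop_iff_nat 1).2 ω.2.2)⟩

theorem jumpTime_shift (ω : P.FVSeq) (s : ℝ≥0) (hs : (s : ℝ) < P.holdTime (ω.1 0)) (n : ℕ) :
    P.jumpTime (ω.shift s hs).1 (n + 1) = P.jumpTime ω.1 (n + 1) - s := by
  simp only [shift, jumpTime, Finset.sum_range_succ', Function.update_self,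
    (ω.2.1 0).holdTime_evolve]
  simp
  ring

theorem trace_shift (ω : P.FVSeq) (s : ℝ≥0) (hs : (s : ℝ) < P.holdTime (ω.1 0)) (t : ℝ≥0) :
    (ω.shift s hs).trace t = ω.trace (t + s) := by
  apply Subtype.ext
  have h1 := ω.jumpTime_le (t + s)
  have h2 := ω.lt_jumpTime (t + s)
  push_cast at h1 h2
  have h0 : (0 : ℝ) ≤ t := t.2
  rcases hn : ω.index (t + s) with _ | n
  · rw [hn] at h2
    have h3 : (ω.shift s hs).index t = 0 := by
      rw [index_eq_iff, jumpTime_shift]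
      refine ⟨by simp [jumpTime], by linarith⟩
    rw [coe_trace_of_index_eq h3, coe_trace_of_index_eq hn]
    simp only [shift, Function.update_self, evolve_evolve, jumpTime, Finset.range_zero,
      Finset.sum_empty, sub_zero]
    push_cast
    rw [add_comm]
  · rw [hn] at h1 h2
    have h3 : (ω.shift s hs).index t = n + 1 := by
      rw [index_eq_iff, jumpTime_shift, jumpTime_shift]
      constructor <;> linarith
    rw [coe_trace_of_index_eq h3, coe_trace_of_index_eq hn, jumpTime_shift]
    have h4 : (ω.shift s hs).1 (n + 1) = ω.1 (n + 1) := by simp [shift]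
    rw [h4]
    push_cast
    congr 1
    ring

theorem measurable_index (t : ℝ≥0) : Measurable fun ω : P.FVSeq => ω.index t := by
  refine measurable_to_countable' fun n => ?_
  have h : (fun ω : P.FVSeq => ω.index t) ⁻¹' {n} =
      {ω | P.jumpTime ω.1 n ≤ t} ∩ {ω | (t : ℝ) < P.jumpTime ω.1 (n + 1)} := by
    ext ω
    exact index_eq_iff
  rw [h]
  exact (measurableSet_le ((measurable_jumpTime n).comp measurable_subtype_coe)
    measurable_const).inter (measurableSet_lt measurable_const
      ((measurable_jumpTime (n + 1)).comp measurable_subtype_coe))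

theorem measurable_trace (t : ℝ≥0) : Measurable fun ω : P.FVSeq => ω.trace t := by
  refine Measurable.subtype_mk ?_
  have h (n : ℕ) : Measurable fun ω : P.FVSeq => P.evolve (ω.1 n) (t - P.jumpTime ω.1 n) :=
    measurable_evolve.comp (((measurable_pi_apply n).comp measurable_subtype_coe).prodMk
      (measurable_const.sub ((measurable_jumpTime n).comp measurable_subtype_coe)))
  have h1 : Measurable fun p : P.FVSeq × ℕ => P.evolve (p.1.1 p.2) (t - P.jumpTime p.1.1 p.2) :=
    measurable_from_prod_countable_left h
  exact h1.comp (measurable_id.prodMk (measurable_index t))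

end FVSeq

/-! ### Smoothing along traces -/

/-- The function `ℒ(φ)(t)` on finitely varying sequences. -/
noncomputable def smoothing (φ : P.GState → ℝ) (t : ℝ≥0) (ω : P.FVSeq) : ℝ :=
  ⨆ u : ℝ≥0, (φ (ω.trace u) - |(u : ℝ) - t|)

/-- `φ` changes at most at unit speed while no jump occurs. -/
def EvolveLipschitz (φ : P.GState → ℝ) : Prop :=
  ∀ (g : P.GState) (s : ℝ≥0) (hs : (s : ℝ) < P.holdTime g.1),
    |φ g - φ ⟨P.evolve g.1 s, g.2.evolve hs⟩| ≤ s

section Smoothing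

variable {φ ψ : P.GState → ℝ}

theorem EvolveLipschitz.abs_sub_le_of_le (hφ : EvolveLipschitz φ) {ω : P.FVSeq} {s t : ℝ≥0}
    (h : ω.index s = ω.index t) (hst : s ≤ t) : |φ (ω.trace s) - φ (ω.trace t)| ≤ t - s := by
  have hst' : (s : ℝ) ≤ t := hst
  have h0 : ((⟨t - s, sub_nonneg.2 hst'⟩ : ℝ≥0) : ℝ) = t - s := rfl
  have h1 := hφ (ω.trace s) ⟨t - s, sub_nonneg.2 hst'⟩ (FVSeq.sub_lt_holdTime_trace h)
  have h2 : ω.trace t = ⟨P.evolve (ω.trace s).1 (t - s),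
      (ω.trace s).2.evolve (FVSeq.sub_lt_holdTime_trace h)⟩ :=
    Subtype.ext (FVSeq.trace_eq_evolve_trace h)
  rw [h2]
  exact h1

theorem EvolveLipschitz.abs_sub_le (hφ : EvolveLipschitz φ) {ω : P.FVSeq} {s t : ℝ≥0}
    (h : ω.index s = ω.index t) : |φ (ω.trace s) - φ (ω.trace t)| ≤ |(s : ℝ) - t| := by
  rcases le_total s t with hst | hst
  · rw [abs_sub_comm (s : ℝ)]
    exact (hφ.abs_sub_le_of_le h hst).trans (le_abs_self _)
  · rw [abs_sub_comm (φ _)]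
    exact (hφ.abs_sub_le_of_le h.symm hst).trans (le_abs_self _)

theorem bddAbove_smoothing (hφ : ∀ g, φ g ∈ Icc (0 : ℝ) 1) (t : ℝ≥0) (ω : P.FVSeq) :
    BddAbove (range fun u : ℝ≥0 => φ (ω.trace u) - |(u : ℝ) - t|) :=
  ⟨1, forall_mem_range.2 fun u => by linarith [(hφ (ω.trace u)).2, abs_nonneg ((u : ℝ) - t)]⟩

theorem smoothing_mem_Icc (hφ : ∀ g, φ g ∈ Icc (0 : ℝ) 1) (t : ℝ≥0) (ω : P.FVSeq) :
    smoothing φ t ω ∈ Icc (0 : ℝ) 1 := by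
  constructor
  · refine le_ciSup_of_le (bddAbove_smoothing hφ t ω) t ?_
    simpa using (hφ _).1
  · exact ciSup_le fun u => by linarith [(hφ (ω.trace u)).2, abs_nonneg ((u : ℝ) - t)]

theorem le_smoothing (hφ : ∀ g, φ g ∈ Icc (0 : ℝ) 1) (t : ℝ≥0) (ω : P.FVSeq) :
    φ (ω.trace t) ≤ smoothing φ t ω :=
  le_ciSup_of_le (bddAbove_smoothing hφ t ω) t (by simp)

theorem abs_smoothing_shift_le (hφ : ∀ g, φ g ∈ Icc (0 : ℝ) 1) (hE : EvolveLipschitz φ)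
    (t : ℝ≥0) (ω : P.FVSeq) (s : ℝ≥0) (hs : (s : ℝ) < P.holdTime (ω.1 0)) :
    |smoothing φ t ω - smoothing φ t (ω.shift s hs)| ≤ s := by
  have hs0 : (0 : ℝ) ≤ s := s.2
  rw [abs_sub_le_iff, sub_le_iff_le_add, sub_le_iff_le_add, add_comm (s : ℝ), add_comm (s : ℝ)]
  constructor
  · refine ciSup_le_ciSup_add (bddAbove_smoothing hφ _ _) fun u ε hε => ?_
    rcases le_total s u with hu | hu
    · have hu' : (s : ℝ) ≤ u := hu
      refine ⟨u - s, ?_⟩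
      rw [FVSeq.trace_shift, tsub_add_cancel_of_le hu, NNReal.coe_sub hu]
      have : |(u : ℝ) - s - t| ≤ |(u : ℝ) - t| + s := by
        rw [abs_le]
        constructor <;> cases abs_cases ((u : ℝ) - t) <;> linarith
      linarith
    · have hu' : (u : ℝ) ≤ s := hu
      have hu0 : (0 : ℝ) ≤ u := u.2
      have ht0 : (0 : ℝ) ≤ t := t.2
      refine ⟨0, ?_⟩
      rw [FVSeq.trace_shift, zero_add]
      have hi : ∀ v : ℝ≥0, v ≤ s → ω.index v = 0 := by
        intro v hv
        have hv' : (v : ℝ) ≤ s := hv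
        refine FVSeq.index_eq_iff.2 ⟨by simp [jumpTime], ?_⟩
        simp only [jumpTime, zero_add, Finset.range_one, Finset.sum_singleton]
        linarith
      have h1 := abs_le.1 (hE.abs_sub_le_of_le ((hi u hu).trans (hi s le_rfl).symm) hu)
      have : |((0 : ℝ≥0) : ℝ) - t| ≤ |(u : ℝ) - t| + u := by
        rw [abs_le]
        push_cast
        constructor <;> cases abs_cases ((u : ℝ) - t) <;> linarith
      linarith
  · refine ciSup_le_ciSup_add (bddAbove_smoothing hφ _ _) fun u ε hε => ⟨u + s, ?_⟩
    rw [FVSeq.trace_shift]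
    push_cast
    have : |(u : ℝ) + s - t| ≤ |(u : ℝ) - t| + s := by
      rw [abs_le]
      constructor <;> cases abs_cases ((u : ℝ) - t) <;> linarith
    linarith

theorem measurable_smoothing (hφ : ∀ g, φ g ∈ Icc (0 : ℝ) 1) (hE : EvolveLipschitz φ)
    (hm : Measurable φ) (t : ℝ≥0) : Measurable (smoothing φ t) := by
  have h : smoothing φ t = fun ω => ⨆ n : ℕ, (φ (ω.trace (TopologicalSpace.denseSeq ℝ≥0 n)) -
      |(TopologicalSpace.denseSeq ℝ≥0 n : ℝ) - t|) := by
    funext ω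
    have hb : BddAbove (range fun n : ℕ => φ (ω.trace (TopologicalSpace.denseSeq ℝ≥0 n)) -
      |(TopologicalSpace.denseSeq ℝ≥0 n : ℝ) - t|) :=
      (bddAbove_smoothing hφ t ω).mono (range_subset_iff.2 fun n => mem_range_self _)
    refine le_antisymm ?_ (ciSup_le fun n => le_ciSup (bddAbove_smoothing hφ t ω) _)
    rw [← add_zero (⨆ n : ℕ, _)]
    refine ciSup_le_ciSup_add hb fun u ε hε => ?_
    obtain ⟨v, huv, hv⟩ := ω.exists_gt_index_eq u
    have huε : u < u + Real.toNNReal (ε / 2) := by simpa using hε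
    obtain ⟨n, hn1, hn2⟩ := (TopologicalSpace.denseRange_denseSeq ℝ≥0).exists_mem_open
      (isOpen_Ioo (a := u) (b := min v (u + Real.toNNReal (ε / 2)))) (nonempty_Ioo.2 (lt_min huv huε))
    refine ⟨n, ?_⟩
    set q := TopologicalSpace.denseSeq ℝ≥0 n
    have h1 := hE.abs_sub_le_of_le (hv q hn1.le (lt_min_iff.1 hn2).1).symm hn1.le
    have h2 : (u : ℝ) < q := hn1
    have h3 : (q : ℝ) < u + ε / 2 := by
      have : ((q : ℝ≥0) : ℝ) < ((u + Real.toNNReal (ε / 2) : ℝ≥0) : ℝ) := (lt_min_iff.1 hn2).2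
      rwa [NNReal.coe_add, Real.coe_toNNReal _ (by linarith)] at this
    have h4 : |(q : ℝ) - t| ≤ |(u : ℝ) - t| + (q - u) := by
      rw [abs_le]
      constructor <;> cases abs_cases ((u : ℝ) - t) <;> linarith
    linarith [(abs_le.1 h1).2]
  rw [h]
  exact Measurable.iSup fun n => (hm.comp (FVSeq.measurable_trace _)).sub measurable_const

theorem abs_smoothing_sub_smoothing_le (hφ : ∀ g, φ g ∈ Icc (0 : ℝ) 1)
    (hψ : ∀ g, ψ g ∈ Icc (0 : ℝ) 1) {c : ℝ} (h : ∀ g, |φ g - ψ g| ≤ c) (s t : ℝ≥0) (ω : P.FVSeq) :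
    |smoothing φ s ω - smoothing ψ t ω| ≤ c + |(s : ℝ) - t| := by
  rw [abs_sub_le_iff, sub_le_iff_le_add, sub_le_iff_le_add, add_comm (c + _), add_comm (c + _)]
  have h1 (u : ℝ≥0) : |(u : ℝ) - t| ≤ |(u : ℝ) - s| + |(s : ℝ) - t| := abs_sub_le _ _ _
  have h2 (u : ℝ≥0) : |(u : ℝ) - s| ≤ |(u : ℝ) - t| + |(s : ℝ) - t| := by
    rw [abs_sub_comm (s : ℝ) t]
    exact abs_sub_le _ _ _
  constructor
  · refine ciSup_le_ciSup_add (bddAbove_smoothing hψ _ _) fun u ε hε => ⟨u, ?_⟩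
    linarith [(abs_le.1 (h (ω.trace u))).2, h1 u]
  · refine ciSup_le_ciSup_add (bddAbove_smoothing hφ _ _) fun u ε hε => ⟨u, ?_⟩
    linarith [(abs_le.1 (h (ω.trace u))).1, h2 u]

end Smoothing

/-! ### Regularity of function expressions -/

/-- The properties shared by all F-function expressions. -/
structure IsRegularF (φ : P.GState → ℝ) : Prop where
  mem_Icc : ∀ g, φ g ∈ Icc (0 : ℝ) 1
  measurable : Measurable φ
  evolveLipschitz : EvolveLipschitz φ

/-- The properties shared by all G-function expressions. -/
structure IsRegularG (γ : P.FVSeq → ℝ) : Prop where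
  mem_Icc : ∀ ω, γ ω ∈ Icc (0 : ℝ) 1
  measurable : Measurable γ
  abs_shift_le : ∀ (ω : P.FVSeq) (s : ℝ≥0) (hs : (s : ℝ) < P.holdTime (ω.1 0)), |γ ω - γ (ω.shift s hs)| ≤ s

theorem integral_tracesLaw_eq (γ : P.FVSeq → ℝ) (g : P.GState) :
    ∫ ω, γ ω ∂P.tracesLaw g = ∫ ω, Function.extend Subtype.val γ 0 ω ∂P.runLaw g.1 := by
  rw [← map_tracesLaw, measurableEmbedding_fvSeq.integral_map]
  simp only [Subtype.val_injective.extend_apply]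

theorem IsRegularG.evolveLipschitz_integral {γ : P.FVSeq → ℝ} (hγ : IsRegularG γ) {k : ℝ}
    (hk : 0 ≤ k) (hk1 : k ≤ 1) : EvolveLipschitz fun g => k * ∫ ω, γ ω ∂P.tracesLaw g := by
  intro g s hs
  have hu : Measurable fun ω : ℕ → P.Config => Function.update ω 0 (P.evolve g.1 s) :=
    measurable_update_left
  have hm : Measurable (Function.extend Subtype.val γ 0) :=
    measurableEmbedding_fvSeq.measurable_extend hγ.measurable measurable_const
  have hI (ω : ℕ → P.Config) : Function.extend Subtype.val γ 0 ω ∈ Icc (0 : ℝ) 1 := by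
    by_cases h : ∃ ω' : P.FVSeq, ω'.1 = ω
    · obtain ⟨ω', rfl⟩ := h
      rw [Subtype.val_injective.extend_apply]
      exact hγ.mem_Icc ω'
    · rw [Function.extend_apply' _ _ _ h]
      exact ⟨le_rfl, zero_le_one⟩
  have key : |∫ ω, Function.extend Subtype.val γ 0 ω ∂P.runLaw g.1 -
      ∫ ω, Function.extend Subtype.val γ 0 (Function.update ω 0 (P.evolve g.1 s)) ∂P.runLaw g.1|
      ≤ s := by
    refine abs_integral_sub_integral_le (integrable_of_mem_Icc hm hI)
      (integrable_of_mem_Icc (hm.comp hu) fun ω => hI _) ?_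
    filter_upwards [g.2.ae_runLaw, g.2.ae_tendsto_jumpTime, ae_runLaw_zero g.1] with ω h1 h2 h3
    have hs' : (s : ℝ) < P.holdTime (ω 0) := h3 ▸ hs
    have h4 := hγ.abs_shift_le ⟨ω, h1, h2⟩ s hs'
    have h5 : Function.update ω 0 (P.evolve g.1 s) = (FVSeq.shift ⟨ω, h1, h2⟩ s hs').1 := by
      simp only [FVSeq.shift, h3]
    have h6 : ω = (⟨ω, h1, h2⟩ : P.FVSeq).1 := rfl
    change |Function.extend Subtype.val γ 0 ω -
      Function.extend Subtype.val γ 0 (Function.update ω 0 (P.evolve g.1 s))| ≤ s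
    rw [h5, Subtype.val_injective.extend_apply]
    nth_rewrite 1 [h6]
    rwa [Subtype.val_injective.extend_apply]
  simp only
  rw [integral_tracesLaw_eq, integral_tracesLaw_eq, runLaw_evolve g.2.hasUniqueFirst.2,
    integral_map hu.aemeasurable hm.aestronglyMeasurable, ← mul_sub, abs_mul, abs_of_nonneg hk]
  calc _ ≤ 1 * (s : ℝ) := mul_le_mul hk1 key (abs_nonneg _) zero_le_one
    _ = s := one_mul _

theorem IsRegularG.integral {γ : P.FVSeq → ℝ} (hγ : IsRegularG γ) {k : ℝ}
    (hk : 0 ≤ k) (hk1 : k ≤ 1) : IsRegularF fun g => k * ∫ ω, γ ω ∂P.tracesLaw g := by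
  refine ⟨fun g => ?_, ?_, hγ.evolveLipschitz_integral hk hk1⟩
  · have h := integral_mem_Icc (μ := P.tracesLaw g) hγ.measurable hγ.mem_Icc
    exact ⟨mul_nonneg hk h.1, mul_le_one₀ hk1 h.1 h.2⟩
  · let κ : Kernel P.GState P.FVSeq := ⟨P.tracesLaw, measurable_tracesLaw⟩
    have : IsMarkovKernel κ := ⟨fun g => inferInstanceAs (IsProbabilityMeasure (P.tracesLaw g))⟩
    exact (hγ.measurable.stronglyMeasurable.integral_kernel (κ := κ)).measurable.const_mul k

theorem IsRegularF.smoothing {φ : P.GState → ℝ} (hφ : IsRegularF φ) (t : ℝ≥0) :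
    IsRegularG (smoothing φ t) :=
  ⟨smoothing_mem_Icc hφ.mem_Icc t, measurable_smoothing hφ.mem_Icc hφ.evolveLipschitz hφ.measurable t,
    abs_smoothing_shift_le hφ.mem_Icc hφ.evolveLipschitz t⟩

theorem min_mem_Icc {a b : ℝ} (ha : a ∈ Icc (0 : ℝ) 1) (hb : b ∈ Icc (0 : ℝ) 1) :
    min a b ∈ Icc (0 : ℝ) 1 :=
  ⟨le_min ha.1 hb.1, (min_le_left _ _).trans ha.2⟩

open Classical in
theorem IsRegularF.prop (p : AP) :
    IsRegularF fun g : P.GState => if p ∈ P.props g.1.1 then (1 : ℝ) else 0 := by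
  refine ⟨fun g => ?_, ?_, fun g s hs => ?_⟩
  · split_ifs <;> simp
  · have h : Measurable fun g : P.Config => if p ∈ P.props g.1 then (1 : ℝ) else 0 :=
      measurable_sigma_iff.2 fun s => measurable_const (a := if p ∈ P.props s then (1 : ℝ) else 0)
    exact h.comp measurable_subtype_coe
  · have : (P.evolve g.1 s).1 = g.1.1 := rfl
    simp [this]

section

variable {k : ℝ}

mutual

theorem isRegularF_evalF (hk : 0 ≤ k) (hk1 : k ≤ 1) : ∀ F : FExpr AP, IsRegularF (P.evalF k F)
  | .one => by
    simp only [evalF]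
    exact ⟨fun g => ⟨zero_le_one, le_rfl⟩, measurable_const, fun g s hs => by simp⟩
  | .prop p => by
    simp only [evalF]
    exact IsRegularF.prop p
  | .min F₁ F₂ => by
    have h1 := isRegularF_evalF hk hk1 F₁
    have h2 := isRegularF_evalF hk hk1 F₂
    simp only [evalF]
    exact ⟨fun g => min_mem_Icc (h1.mem_Icc g) (h2.mem_Icc g), h1.measurable.min h2.measurable,
      fun g s hs => abs_min_sub_min_le (h1.evolveLipschitz g s hs) (h2.evolveLipschitz g s hs)⟩
  | .comp h hh F => by
    have h1 := isRegularF_evalF hk hk1 F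
    simp only [evalF]
    exact ⟨fun g => hh.1 (h1.mem_Icc g), hh.measurable_comp h1.measurable h1.mem_Icc,
      fun g s hs => (hh.2 _ (h1.mem_Icc _) _ (h1.mem_Icc _)).trans (h1.evolveLipschitz g s hs)⟩
  | .integral G => by
    simp only [evalF]
    exact (isRegularG_evalG hk hk1 G).integral hk hk1

theorem isRegularG_evalG (hk : 0 ≤ k) (hk1 : k ≤ 1) : ∀ G : GExpr AP, IsRegularG (P.evalG k G)
  | .smooth F t => by
    simp only [evalG]
    exact (isRegularF_evalF hk hk1 F).smoothing t
  | .min G₁ G₂ => by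
    have h1 := isRegularG_evalG hk hk1 G₁
    have h2 := isRegularG_evalG hk hk1 G₂
    simp only [evalG]
    exact ⟨fun g => min_mem_Icc (h1.mem_Icc g) (h2.mem_Icc g), h1.measurable.min h2.measurable,
      fun ω s hs => abs_min_sub_min_le (h1.abs_shift_le ω s hs) (h2.abs_shift_le ω s hs)⟩
  | .comp h hh G => by
    have h1 := isRegularG_evalG hk hk1 G
    simp only [evalG]
    exact ⟨fun g => hh.1 (h1.mem_Icc g), hh.measurable_comp h1.measurable h1.mem_Icc,
      fun ω s hs => (hh.2 _ (h1.mem_Icc _) _ (h1.mem_Icc _)).trans (h1.abs_shift_le ω s hs)⟩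

end

end

end GSMP

namespace GSMP

/-! ### The Skorohod lifting -/

section Skorohod

variable {X : Type*} {m m' : X → X → ℝ}

theorem bddBelow_skorohod (h0 : ∀ x y, 0 ≤ m x y) {ι : Type*} (a b : ι → X) (c : ι → ℝ) :
    BddBelow (range fun i => max (m (a i) (b i)) (c i)) :=
  ⟨0, forall_mem_range.2 fun _ => le_max_of_le_left (h0 _ _)⟩

theorem bddAbove_skorohod_left (h0 : ∀ x y, 0 ≤ m x y) (h1 : ∀ x y, m x y ≤ 1) (f g : ℝ≥0 → X) :
    BddAbove (range fun t : ℝ≥0 => ⨅ t' : ℝ≥0, max (m (f t) (g t')) |(t : ℝ) - t'|) := by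
  refine ⟨1, forall_mem_range.2 fun t => ?_⟩
  refine (ciInf_le (bddBelow_skorohod h0 (fun _ => f t) g _) t).trans ?_
  simpa using h1 _ _

theorem bddAbove_skorohod_right (h0 : ∀ x y, 0 ≤ m x y) (h1 : ∀ x y, m x y ≤ 1) (f g : ℝ≥0 → X) :
    BddAbove (range fun t' : ℝ≥0 => ⨅ t : ℝ≥0, max (m (f t) (g t')) |(t : ℝ) - t'|) := by
  refine ⟨1, forall_mem_range.2 fun t => ?_⟩
  refine (ciInf_le (bddBelow_skorohod h0 f (fun _ => g t) _) t).trans ?_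
  simpa using h1 _ _

theorem skorohod_nonneg (h0 : ∀ x y, 0 ≤ m x y) (f g : ℝ≥0 → X) : 0 ≤ skorohod m f g :=
  le_max_of_le_left (Real.iSup_nonneg fun _ => Real.iInf_nonneg fun _ =>
    le_max_of_le_left (h0 _ _))

theorem skorohod_mono (h0 : ∀ x y, 0 ≤ m x y) (h1 : ∀ x y, m' x y ≤ 1)
    (h : ∀ x y, m x y ≤ m' x y) (f g : ℝ≥0 → X) : skorohod m f g ≤ skorohod m' f g := by
  have h0' (x y) : 0 ≤ m' x y := (h0 x y).trans (h x y)
  exact max_le_max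
    (ciSup_mono (bddAbove_skorohod_left h0' h1 f g) fun t =>
      ciInf_mono (bddBelow_skorohod h0 (fun _ => f t) g _) fun t' => max_le_max (h _ _) le_rfl)
    (ciSup_mono (bddAbove_skorohod_right h0' h1 f g) fun t =>
      ciInf_mono (bddBelow_skorohod h0 f (fun _ => g t) _) fun t' => max_le_max (h _ _) le_rfl)

theorem exists_of_skorohod_lt (h0 : ∀ x y, 0 ≤ m x y) (h1 : ∀ x y, m x y ≤ 1) {f g : ℝ≥0 → X}
    {r : ℝ} (h : skorohod m f g < r) (t : ℝ≥0) :
    ∃ t' : ℝ≥0, m (f t) (g t') < r ∧ |(t : ℝ) - t'| < r := by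
  have h2 := (le_ciSup (bddAbove_skorohod_left h0 h1 f g) t).trans_lt ((le_max_left _ _).trans_lt h)
  obtain ⟨t', ht'⟩ := exists_lt_of_ciInf_lt h2
  exact ⟨t', max_lt_iff.1 ht'⟩

theorem exists_of_skorohod_lt' (h0 : ∀ x y, 0 ≤ m x y) (h1 : ∀ x y, m x y ≤ 1) {f g : ℝ≥0 → X}
    {r : ℝ} (h : skorohod m f g < r) (t' : ℝ≥0) :
    ∃ t : ℝ≥0, m (f t) (g t') < r ∧ |(t : ℝ) - t'| < r := by
  have h2 := (le_ciSup (bddAbove_skorohod_right h0 h1 f g) t').trans_lt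
    ((le_max_right _ _).trans_lt h)
  obtain ⟨t, ht⟩ := exists_lt_of_ciInf_lt h2
  exact ⟨t, max_lt_iff.1 ht⟩

theorem exists_of_lt_skorohod (h0 : ∀ x y, 0 ≤ m x y) {f g : ℝ≥0 → X} {r : ℝ}
    (h : r < skorohod m f g) :
    (∃ t : ℝ≥0, ∀ t' : ℝ≥0, |(t : ℝ) - t'| ≤ r → r < m (f t) (g t')) ∨
      ∃ t' : ℝ≥0, ∀ t : ℝ≥0, |(t : ℝ) - t'| ≤ r → r < m (f t) (g t') := by
  rcases lt_max_iff.1 h with h | h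
  · obtain ⟨t, ht⟩ := exists_lt_of_lt_ciSup h
    refine Or.inl ⟨t, fun t' h' => ?_⟩
    have := ht.trans_le (ciInf_le (bddBelow_skorohod h0 (fun _ => f t) g _) t')
    exact (lt_max_iff.1 this).resolve_right (not_lt.2 h')
  · obtain ⟨t, ht⟩ := exists_lt_of_lt_ciSup h
    refine Or.inr ⟨t, fun t' h' => ?_⟩
    have := ht.trans_le (ciInf_le (bddBelow_skorohod h0 f (fun _ => g t) _) t')
    exact (lt_max_iff.1 this).resolve_right (not_lt.2 h')

end Skorohod

/-! ### The Wasserstein lifting -/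

section Wasserstein

variable {X : Type*} [MeasurableSpace X] {d d' : X → X → ℝ} {μ ν ρ : Measure X}

theorem wasserstein_le {c : ℝ} (hc : 0 ≤ c)
    (h : ∀ h : X → ℝ, Measurable h → (∀ x, h x ∈ Icc (0 : ℝ) 1) → (∀ x y, |h x - h y| ≤ d x y) →
      ∫ x, h x ∂μ - ∫ x, h x ∂ν ≤ c) : wasserstein d μ ν ≤ c := by
  refine Real.sSup_le ?_ hc
  rintro r ⟨φ, h1, h2, h3, rfl⟩
  exact h φ h1 h2 h3

theorem wasserstein_self : wasserstein d μ μ ≤ 0 :=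
  wasserstein_le le_rfl fun _ _ _ _ => (sub_self _).le

variable [IsProbabilityMeasure μ] [IsProbabilityMeasure ν] [IsProbabilityMeasure ρ]

theorem integral_sub_le_one {h : X → ℝ} (hm : Measurable h) (h01 : ∀ x, h x ∈ Icc (0 : ℝ) 1) :
    ∫ x, h x ∂μ - ∫ x, h x ∂ν ≤ 1 := by
  have h1 := (integral_mem_Icc (μ := μ) hm h01).2
  have h2 := (integral_mem_Icc (μ := ν) hm h01).1
  linarith

theorem le_wasserstein {h : X → ℝ} (hm : Measurable h) (h01 : ∀ x, h x ∈ Icc (0 : ℝ) 1)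
    (hd : ∀ x y, |h x - h y| ≤ d x y) : ∫ x, h x ∂μ - ∫ x, h x ∂ν ≤ wasserstein d μ ν := by
  refine le_csSup ⟨1, ?_⟩ ⟨h, hm, h01, hd, rfl⟩
  rintro r ⟨φ, h1, h2, -, rfl⟩
  exact integral_sub_le_one h1 h2

theorem wasserstein_nonneg (h0 : ∀ x y, 0 ≤ d x y) : 0 ≤ wasserstein d μ ν := by
  simpa using le_wasserstein (μ := μ) (ν := ν) (h := fun _ => 0) (d := d) measurable_const
    (fun _ => ⟨le_rfl, zero_le_one⟩) (fun x y => by simpa using h0 x y)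

theorem wasserstein_le_one : wasserstein d μ ν ≤ 1 :=
  wasserstein_le zero_le_one fun _ h1 h2 _ => integral_sub_le_one h1 h2

theorem wasserstein_comm_le (h0 : ∀ x y, 0 ≤ d x y) : wasserstein d μ ν ≤ wasserstein d ν μ := by
  refine wasserstein_le (wasserstein_nonneg h0) fun h h1 h2 h3 => ?_
  have h4 := le_wasserstein (μ := ν) (ν := μ) (h := fun x => 1 - h x) (d := d)
    (measurable_const.sub h1)
    (fun x => ⟨sub_nonneg.2 (h2 x).2, sub_le_self _ (h2 x).1⟩) (fun x y => by
      rw [sub_sub_sub_cancel_left, abs_sub_comm]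
      exact h3 x y)
  rw [integral_sub (integrable_const _) (integrable_of_mem_Icc h1 h2),
    integral_sub (integrable_const _) (integrable_of_mem_Icc h1 h2)] at h4
  simp only [integral_const, probReal_univ, smul_eq_mul, mul_one] at h4
  linarith

theorem wasserstein_triangle (h0 : ∀ x y, 0 ≤ d x y) :
    wasserstein d μ ρ ≤ wasserstein d μ ν + wasserstein d ν ρ := by
  refine wasserstein_le (add_nonneg (wasserstein_nonneg h0) (wasserstein_nonneg h0))
    fun h h1 h2 h3 => ?_
  have h4 := le_wasserstein (μ := μ) (ν := ν) h1 h2 h3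
  have h5 := le_wasserstein (μ := ν) (ν := ρ) h1 h2 h3
  linarith

theorem wasserstein_mono (h0 : ∀ x y, 0 ≤ d x y) (h : ∀ x y, d x y ≤ d' x y) :
    wasserstein d μ ν ≤ wasserstein d' μ ν :=
  wasserstein_le (wasserstein_nonneg fun x y => (h0 x y).trans (h x y)) fun _ h1 h2 h3 =>
    le_wasserstein h1 h2 fun x y => (h3 x y).trans (h x y)

end Wasserstein

/-! ### The least prefixed point of the functional -/

variable {S E AP : Type*} [Fintype S] {P : GSMP S E AP} {k : ℝ}
  {m m' : P.GState → P.GState → ℝ}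

theorem bisimFunctional_of_ne {g g' : P.GState} (h : P.props g.1.1 ≠ P.props g'.1.1) :
    P.bisimFunctional k m g g' = 1 := if_pos h

theorem bisimFunctional_of_eq {g g' : P.GState} (h : P.props g.1.1 = P.props g'.1.1) :
    P.bisimFunctional k m g g' =
      k * wasserstein (fun ω ω' : P.FVSeq => skorohod m ω.trace ω'.trace)
        (P.tracesLaw g) (P.tracesLaw g') := if_neg (not_not.2 h)

theorem isAdmissible_bisimFunctional (hk : 0 ≤ k) (hk1 : k ≤ 1) (hm : P.IsAdmissible m) :
    P.IsAdmissible (P.bisimFunctional k m) := by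
  have h0 (ω ω' : P.FVSeq) : 0 ≤ skorohod m ω.trace ω'.trace := skorohod_nonneg hm.1.nonneg _ _
  have hW0 (g g' : P.GState) := wasserstein_nonneg (μ := P.tracesLaw g) (ν := P.tracesLaw g') h0
  have hnn (g g') : 0 ≤ P.bisimFunctional k m g g' := by
    by_cases h : P.props g.1.1 = P.props g'.1.1
    · rw [bisimFunctional_of_eq h]
      exact mul_nonneg hk (hW0 g g')
    · rw [bisimFunctional_of_ne h]
      exact zero_le_one
  have hle (g g') : P.bisimFunctional k m g g' ≤ 1 := by
    by_cases h : P.props g.1.1 = P.props g'.1.1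
    · rw [bisimFunctional_of_eq h]
      exact mul_le_one₀ hk1 (hW0 g g') wasserstein_le_one
    · rw [bisimFunctional_of_ne h]
  have hsymm (g g') : P.bisimFunctional k m g g' ≤ P.bisimFunctional k m g' g := by
    by_cases h : P.props g.1.1 = P.props g'.1.1
    · rw [bisimFunctional_of_eq h, bisimFunctional_of_eq h.symm]
      exact mul_le_mul_of_nonneg_left (wasserstein_comm_le h0) hk
    · rw [bisimFunctional_of_ne h, bisimFunctional_of_ne (Ne.symm h)]
  refine ⟨⟨hnn, hle, fun g => ?_, fun g g' => (hsymm g g').antisymm (hsymm g' g),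
    fun g₁ g₂ g₃ => ?_⟩, fun g g' h => bisimFunctional_of_ne h⟩
  · rw [bisimFunctional_of_eq rfl, (wasserstein_self).antisymm (hW0 g g), mul_zero]
  · by_cases h12 : P.props g₁.1.1 = P.props g₂.1.1
    · by_cases h23 : P.props g₂.1.1 = P.props g₃.1.1
      · rw [bisimFunctional_of_eq h12, bisimFunctional_of_eq h23,
          bisimFunctional_of_eq (h12.trans h23), ← mul_add]
        exact mul_le_mul_of_nonneg_left (wasserstein_triangle h0) hk
      · rw [bisimFunctional_of_ne h23]
        linarith [hle g₁ g₃, hnn g₁ g₂]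
    · rw [bisimFunctional_of_ne h12]
      linarith [hle g₁ g₃, hnn g₂ g₃]

theorem bisimFunctional_mono (hk : 0 ≤ k) (hm : P.IsAdmissible m) (hm' : P.IsAdmissible m')
    (h : ∀ g g', m g g' ≤ m' g g') (g g' : P.GState) :
    P.bisimFunctional k m g g' ≤ P.bisimFunctional k m' g g' := by
  by_cases hp : P.props g.1.1 = P.props g'.1.1
  · rw [bisimFunctional_of_eq hp, bisimFunctional_of_eq hp]
    exact mul_le_mul_of_nonneg_left (wasserstein_mono
      (fun ω ω' => skorohod_nonneg hm.1.nonneg _ _)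
      fun ω ω' => skorohod_mono hm.1.nonneg hm'.1.le_one h _ _) hk
  · rw [bisimFunctional_of_ne hp, bisimFunctional_of_ne hp]

open Classical in
/-- The least element of the class of admissible pseudometrics. -/
noncomputable def propsDist (g g' : P.GState) : ℝ :=
  if P.props g.1.1 = P.props g'.1.1 then 0 else 1

theorem propsDist_le (hm : P.IsAdmissible m) (g g' : P.GState) : propsDist g g' ≤ m g g' := by
  unfold propsDist
  split_ifs with h
  · exact hm.1.nonneg _ _
  · exact (hm.2 _ _ h).ge

theorem isAdmissible_propsDist : P.IsAdmissible propsDist := by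
  refine ⟨⟨fun g g' => ?_, fun g g' => ?_, fun g => ?_, fun g g' => ?_, fun g₁ g₂ g₃ => ?_⟩,
    fun g g' h => if_neg h⟩
  · unfold propsDist
    split_ifs <;> simp
  · unfold propsDist
    split_ifs <;> simp
  · simp [propsDist]
  · simp [propsDist, eq_comm]
  · unfold propsDist
    split_ifs with h1 h2 h3 <;> simp_all

/-- The pointwise supremum of a nonempty set of admissible pseudometrics is admissible. -/
theorem isAdmissible_iSup {L : Set (P.GState → P.GState → ℝ)} (hL : L.Nonempty)
    (h : ∀ m ∈ L, P.IsAdmissible m) : P.IsAdmissible fun g g' => ⨆ m : L, m.1 g g' := by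
  have : Nonempty L := hL.to_subtype
  have hb (g g' : P.GState) : BddAbove (range fun m : L => m.1 g g') :=
    ⟨1, forall_mem_range.2 fun m => (h m m.2).1.le_one g g'⟩
  refine ⟨⟨fun g g' => Real.iSup_nonneg fun m => (h m m.2).1.nonneg g g',
    fun g g' => ciSup_le fun m => (h m m.2).1.le_one g g', fun g => ?_, fun g g' => ?_,
    fun g₁ g₂ g₃ => ciSup_le fun m => ?_⟩, fun g g' hp => ?_⟩
  · simp [(h _ (Subtype.property _)).1.self g]
  · simp only [fun m : L => (h m m.2).1.symm g g']
  · exact ((h m m.2).1.triangle g₁ g₂ g₃).trans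
      (add_le_add (le_ciSup (hb g₁ g₂) m) (le_ciSup (hb g₂ g₃) m))
  · simp only [fun m : L => (h m m.2).2 g g' hp]
    simp

theorem exists_least_prefixedPoint (hk : 0 ≤ k) (hk1 : k ≤ 1) :
    ∃ m : P.GState → P.GState → ℝ, P.IsAdmissible m ∧ P.bisimFunctional k m = m ∧
      ∀ m', P.IsAdmissible m' → (∀ g g', P.bisimFunctional k m' g g' ≤ m' g g') →
        ∀ g g', m g g' ≤ m' g g' := by
  let L : Set (P.GState → P.GState → ℝ) := {m | P.IsAdmissible m ∧ ∀ m', P.IsAdmissible m' →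
    (∀ g g', P.bisimFunctional k m' g g' ≤ m' g g') → ∀ g g', m g g' ≤ m' g g'}
  have hL : L.Nonempty := ⟨propsDist, isAdmissible_propsDist, fun m' hm' _ => propsDist_le hm'⟩
  have : Nonempty L := hL.to_subtype
  let m₀ : P.GState → P.GState → ℝ := fun g g' => ⨆ m : L, m.1 g g'
  have hm₀ : P.IsAdmissible m₀ := isAdmissible_iSup hL fun m hm => hm.1
  have hlow : ∀ m', P.IsAdmissible m' → (∀ g g', P.bisimFunctional k m' g g' ≤ m' g g') →
      ∀ g g', m₀ g g' ≤ m' g g' := fun m' h1 h2 g g' => ciSup_le fun m => m.2.2 m' h1 h2 g g'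
  have hFm₀ := isAdmissible_bisimFunctional hk hk1 hm₀
  have hpre : ∀ g g', P.bisimFunctional k m₀ g g' ≤ m₀ g g' := by
    have hmem : P.bisimFunctional k m₀ ∈ L := ⟨hFm₀, fun m' h1 h2 g g' =>
      (bisimFunctional_mono hk hm₀ h1 (hlow m' h1 h2) g g').trans (h2 g g')⟩
    exact fun g g' => le_ciSup (f := fun m : L => m.1 g g')
      ⟨1, forall_mem_range.2 fun m => m.2.1.1.le_one g g'⟩ ⟨_, hmem⟩
  refine ⟨m₀, hm₀, ?_, hlow⟩
  funext g g'
  exact (hpre g g').antisymm (hlow _ hFm₀ (bisimFunctional_mono hk hFm₀ hm₀ hpre) g g')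

end GSMP

namespace GSMP

theorem abs_sub_le_one_of_mem_Icc {a b : ℝ} (ha : a ∈ Icc (0 : ℝ) 1) (hb : b ∈ Icc (0 : ℝ) 1) :
    |a - b| ≤ 1 :=
  abs_le.2 ⟨by linarith [ha.1, hb.2], by linarith [ha.2, hb.1]⟩

variable {S E AP : Type*} [Fintype S] {P : GSMP S E AP} {k : ℝ}

/-! ### The logical pseudometric -/

theorem bddAbove_logicalDist (hk : 0 ≤ k) (hk1 : k ≤ 1) (g g' : P.GState) :
    BddAbove (range fun F : FExpr AP => |P.evalF k F g - P.evalF k F g'|) :=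
  ⟨1, forall_mem_range.2 fun F => abs_sub_le_one_of_mem_Icc
    ((isRegularF_evalF hk hk1 F).mem_Icc g) ((isRegularF_evalF hk hk1 F).mem_Icc g')⟩

theorem abs_evalF_sub_le (hk : 0 ≤ k) (hk1 : k ≤ 1) (F : FExpr AP) (g g' : P.GState) :
    |P.evalF k F g - P.evalF k F g'| ≤ P.logicalDist k g g' :=
  le_ciSup (bddAbove_logicalDist hk hk1 g g') F

instance : Nonempty (FExpr AP) := ⟨.one⟩

theorem isPseudometric_logicalDist (hk : 0 ≤ k) (hk1 : k ≤ 1) :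
    IsPseudometric (P.logicalDist k) := by
  refine ⟨fun g g' => Real.iSup_nonneg fun F => abs_nonneg _, fun g g' => ciSup_le fun F => ?_,
    fun g => ?_, fun g g' => ?_, fun g₁ g₂ g₃ => ciSup_le fun F => ?_⟩
  · exact abs_sub_le_one_of_mem_Icc ((isRegularF_evalF hk hk1 F).mem_Icc g)
      ((isRegularF_evalF hk hk1 F).mem_Icc g')
  · simp [logicalDist]
  · unfold logicalDist
    congr 1
    funext F
    exact abs_sub_comm _ _
  · exact (abs_sub_le _ (P.evalF k F g₂) _).trans
      (add_le_add (abs_evalF_sub_le hk hk1 F g₁ g₂) (abs_evalF_sub_le hk hk1 F g₂ g₃))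

theorem isAdmissible_logicalDist (hk : 0 ≤ k) (hk1 : k ≤ 1) :
    P.IsAdmissible (P.logicalDist k) := by
  have hd := isPseudometric_logicalDist (P := P) hk hk1
  refine ⟨hd, fun g g' hp => (hd.le_one g g').antisymm ?_⟩
  obtain ⟨p, hp⟩ : ∃ p, ¬ (p ∈ P.props g.1.1 ↔ p ∈ P.props g'.1.1) := by
    by_contra! h
    exact hp (Set.ext h)
  refine le_trans ?_ (abs_evalF_sub_le hk hk1 (.prop p) g g')
  simp only [evalF]
  by_cases h1 : p ∈ P.props g.1.1 <;> by_cases h2 : p ∈ P.props g'.1.1 <;> simp_all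

/-! ### Upper bound of the logical pseudometric by fixed points -/

section UpperBound

variable {m : P.GState → P.GState → ℝ}

theorem abs_smoothing_sub_le_skorohod (hm : P.IsAdmissible m) {φ : P.GState → ℝ}
    (hφ : ∀ g, φ g ∈ Icc (0 : ℝ) 1) {c : ℝ} (hc : 0 ≤ c)
    (h : ∀ g g', |φ g - φ g'| ≤ c * m g g') (t : ℝ≥0) (ω ω' : P.FVSeq) :
    |smoothing φ t ω - smoothing φ t ω'| ≤ (c + 1) * skorohod m ω.trace ω'.trace := by
  have hr (ε : ℝ) (hε : 0 < ε) : skorohod m ω.trace ω'.trace <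
      skorohod m ω.trace ω'.trace + ε / (c + 1) := lt_add_of_pos_right _ (by positivity)
  have he (ε : ℝ) : (c + 1) * (skorohod m ω.trace ω'.trace + ε / (c + 1)) =
      (c + 1) * skorohod m ω.trace ω'.trace + ε := by
    field_simp
  rw [abs_sub_le_iff, sub_le_iff_le_add', sub_le_iff_le_add']
  constructor
  · refine ciSup_le_ciSup_add (bddAbove_smoothing hφ _ _) fun u ε hε => ?_
    obtain ⟨v, h1, h2⟩ := exists_of_skorohod_lt hm.1.nonneg hm.1.le_one (hr ε hε) u
    refine ⟨v, ?_⟩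
    have h3 := (abs_le.1 (h (ω.trace u) (ω'.trace v))).2
    have h4 := mul_le_mul_of_nonneg_left h1.le hc
    have h5 := abs_sub_le (v : ℝ) u t
    rw [abs_sub_comm (v : ℝ) u] at h5
    linarith [he ε]
  · refine ciSup_le_ciSup_add (bddAbove_smoothing hφ _ _) fun v ε hε => ?_
    obtain ⟨u, h1, h2⟩ := exists_of_skorohod_lt' hm.1.nonneg hm.1.le_one (hr ε hε) v
    refine ⟨u, ?_⟩
    have h3 := (abs_le.1 (h (ω.trace u) (ω'.trace v))).1
    have h4 := mul_le_mul_of_nonneg_left h1.le hc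
    have h5 := abs_sub_le (u : ℝ) v t
    linarith [he ε]

/-- Replacing the parts of nesting depth `n` of an expression gives an approximation that is
Lipschitz with respect to `m`. -/
theorem exists_lipschitz_GExpr (hk : 0 ≤ k) (hk1 : k ≤ 1) (hm : P.IsAdmissible m) {c ε : ℝ}
    (hc : 0 ≤ c) (hF : ∀ F : FExpr AP, ∃ F' : FExpr AP,
      (∀ g, |P.evalF k F g - P.evalF k F' g| ≤ ε) ∧
      ∀ g g', |P.evalF k F' g - P.evalF k F' g'| ≤ c * m g g') :
    ∀ G : GExpr AP, ∃ G' : GExpr AP, (∀ ω, |P.evalG k G ω - P.evalG k G' ω| ≤ ε) ∧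
      ∀ ω ω', |P.evalG k G' ω - P.evalG k G' ω'| ≤ (c + 1) * skorohod m ω.trace ω'.trace
  | .smooth F t => by
    obtain ⟨F', h1, h2⟩ := hF F
    refine ⟨.smooth F' t, fun ω => ?_, fun ω ω' => ?_⟩
    · have h3 := abs_smoothing_sub_smoothing_le (isRegularF_evalF hk hk1 F).mem_Icc
        (isRegularF_evalF hk hk1 F').mem_Icc h1 t t ω
      rw [sub_self, abs_zero, add_zero] at h3
      simp only [evalG]
      exact h3
    · simp only [evalG]
      exact abs_smoothing_sub_le_skorohod hm (isRegularF_evalF hk hk1 F').mem_Icc hc h2 t ω ω'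
  | .min G₁ G₂ => by
    obtain ⟨G₁', h1, h2⟩ := exists_lipschitz_GExpr hk hk1 hm hc hF G₁
    obtain ⟨G₂', h3, h4⟩ := exists_lipschitz_GExpr hk hk1 hm hc hF G₂
    refine ⟨.min G₁' G₂', fun ω => ?_, fun ω ω' => ?_⟩ <;> simp only [evalG]
    · exact abs_min_sub_min_le (h1 ω) (h3 ω)
    · exact abs_min_sub_min_le (h2 ω ω') (h4 ω ω')
  | .comp h hh G => by
    obtain ⟨G', h1, h2⟩ := exists_lipschitz_GExpr hk hk1 hm hc hF G
    have hG := (isRegularG_evalG (P := P) hk hk1 G).mem_Icc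
    have hG' := (isRegularG_evalG (P := P) hk hk1 G').mem_Icc
    refine ⟨.comp h hh G', fun ω => ?_, fun ω ω' => ?_⟩ <;> simp only [evalG]
    · exact (hh.2 _ (hG _) _ (hG' _)).trans (h1 ω)
    · exact (hh.2 _ (hG' _) _ (hG' _)).trans (h2 ω ω')

theorem abs_integral_sub_le_of_lipschitz (hk : 0 ≤ k) (hm : P.IsAdmissible m)
    (hfix : P.bisimFunctional k m = m) {γ : P.FVSeq → ℝ} (hγ : IsRegularG γ) {c : ℝ} (hc : 1 ≤ c)
    (h : ∀ ω ω', |γ ω - γ ω'| ≤ c * skorohod m ω.trace ω'.trace) {g g' : P.GState}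
    (hp : P.props g.1.1 = P.props g'.1.1) :
    |k * ∫ ω, γ ω ∂P.tracesLaw g - k * ∫ ω, γ ω ∂P.tracesLaw g'| ≤ c * m g g' := by
  have hc0 : 0 < c := zero_lt_one.trans_le hc
  have key (g g' : P.GState) (hp : P.props g.1.1 = P.props g'.1.1) :
      k * ∫ ω, γ ω ∂P.tracesLaw g - k * ∫ ω, γ ω ∂P.tracesLaw g' ≤ c * m g g' := by
    have h1 := le_wasserstein (μ := P.tracesLaw g) (ν := P.tracesLaw g') (h := fun ω => γ ω / c)
      (d := fun ω ω' => skorohod m ω.trace ω'.trace) (hγ.measurable.div_const c)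
      (fun ω => ⟨div_nonneg (hγ.mem_Icc ω).1 hc0.le,
        (div_le_one hc0).2 ((hγ.mem_Icc ω).2.trans hc)⟩)
      (fun ω ω' => by
        rw [← sub_div, abs_div, abs_of_pos hc0, div_le_iff₀' hc0]
        exact h ω ω')
    rw [integral_div, integral_div, ← sub_div, div_le_iff₀' hc0] at h1
    rw [← hfix, bisimFunctional_of_eq hp, ← mul_sub, mul_left_comm]
    exact mul_le_mul_of_nonneg_left h1 hk
  rw [abs_sub_le_iff]
  refine ⟨key g g' hp, ?_⟩
  rw [hm.1.symm g g']
  exact key g' g hp.symm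

theorem exists_lipschitz_FExpr_succ (hk : 0 ≤ k) (hk1 : k ≤ 1) (hm : P.IsAdmissible m)
    (hfix : P.bisimFunctional k m = m) {c ε : ℝ} (hc : 0 ≤ c) (hε : 0 ≤ ε)
    (hG : ∀ G : GExpr AP, ∃ G' : GExpr AP, (∀ ω, |P.evalG k G ω - P.evalG k G' ω| ≤ ε) ∧
      ∀ ω ω', |P.evalG k G' ω - P.evalG k G' ω'| ≤ (c + 1) * skorohod m ω.trace ω'.trace) :
    ∀ F : FExpr AP, ∃ F' : FExpr AP, (∀ g, |P.evalF k F g - P.evalF k F' g| ≤ k * ε) ∧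
      ∀ g g', |P.evalF k F' g - P.evalF k F' g'| ≤ (c + 1) * m g g'
  | .one => by
    refine ⟨.one, fun g => by simpa using mul_nonneg hk hε, fun g g' => ?_⟩
    simpa [evalF] using mul_nonneg (by linarith) (hm.1.nonneg g g')
  | .prop p => by
    refine ⟨.prop p, fun g => by simpa using mul_nonneg hk hε, fun g g' => ?_⟩
    have hnn : 0 ≤ (c + 1) * m g g' := mul_nonneg (by linarith) (hm.1.nonneg g g')
    by_cases h : P.props g.1.1 = P.props g'.1.1
    · have h' : P.evalF k (.prop p) g = P.evalF k (.prop p) g' := by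
        simp only [evalF]
        congr 1
        rw [h]
      rwa [h', sub_self, abs_zero]
    · rw [hm.2 g g' h, mul_one]
      refine le_trans (abs_sub_le_one_of_mem_Icc ?_ ?_) (by linarith) <;>
      exact (isRegularF_evalF hk hk1 _).mem_Icc _
  | .min F₁ F₂ => by
    obtain ⟨F₁', h1, h2⟩ := exists_lipschitz_FExpr_succ hk hk1 hm hfix hc hε hG F₁
    obtain ⟨F₂', h3, h4⟩ := exists_lipschitz_FExpr_succ hk hk1 hm hfix hc hε hG F₂
    refine ⟨.min F₁' F₂', fun g => ?_, fun g g' => ?_⟩ <;> simp only [evalF]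
    · exact abs_min_sub_min_le (h1 g) (h3 g)
    · exact abs_min_sub_min_le (h2 g g') (h4 g g')
  | .comp h hh F => by
    obtain ⟨F', h1, h2⟩ := exists_lipschitz_FExpr_succ hk hk1 hm hfix hc hε hG F
    have hF := (isRegularF_evalF (P := P) hk hk1 F).mem_Icc
    have hF' := (isRegularF_evalF (P := P) hk hk1 F').mem_Icc
    refine ⟨.comp h hh F', fun g => ?_, fun g g' => ?_⟩ <;> simp only [evalF]
    · exact (hh.2 _ (hF _) _ (hF' _)).trans (h1 g)
    · exact (hh.2 _ (hF' _) _ (hF' _)).trans (h2 g g')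
  | .integral G => by
    obtain ⟨G', h1, h2⟩ := hG G
    have hrG := isRegularG_evalG (P := P) hk hk1 G
    have hrG' := isRegularG_evalG (P := P) hk hk1 G'
    refine ⟨.integral G', fun g => ?_, fun g g' => ?_⟩
    · simp only [evalF]
      rw [← mul_sub, abs_mul, abs_of_nonneg hk]
      exact mul_le_mul_of_nonneg_left (abs_integral_sub_integral_le
        (integrable_of_mem_Icc hrG.measurable hrG.mem_Icc)
        (integrable_of_mem_Icc hrG'.measurable hrG'.mem_Icc) (Eventually.of_forall h1)) hk
    · by_cases h : P.props g.1.1 = P.props g'.1.1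
      · simp only [evalF]
        exact abs_integral_sub_le_of_lipschitz hk hm hfix hrG' (by linarith) h2 h
      · rw [hm.2 g g' h, mul_one]
        refine le_trans (abs_sub_le_one_of_mem_Icc ?_ ?_) (by linarith) <;>
        exact (isRegularF_evalF hk hk1 _).mem_Icc _

theorem exists_lipschitz_FExpr (hk : 0 ≤ k) (hk1 : k ≤ 1) (hm : P.IsAdmissible m)
    (hfix : P.bisimFunctional k m = m) (n : ℕ) (F : FExpr AP) : ∃ F' : FExpr AP,
      (∀ g, |P.evalF k F g - P.evalF k F' g| ≤ k ^ n) ∧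
      ∀ g g', |P.evalF k F' g - P.evalF k F' g'| ≤ n * m g g' := by
  induction n generalizing F with
  | zero =>
    refine ⟨.one, fun g => ?_, fun g g' => by simp [evalF]⟩
    rw [pow_zero]
    exact abs_sub_le_one_of_mem_Icc ((isRegularF_evalF hk hk1 _).mem_Icc _)
      ((isRegularF_evalF hk hk1 _).mem_Icc _)
  | succ n ih =>
    rw [pow_succ', Nat.cast_succ]
    exact exists_lipschitz_FExpr_succ hk hk1 hm hfix (Nat.cast_nonneg n) (pow_nonneg hk n)
      (exists_lipschitz_GExpr hk hk1 hm (Nat.cast_nonneg n) ih) F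

theorem logicalDist_le (hk : 0 ≤ k) (hk1 : k ≤ 1) (hm : P.IsAdmissible m)
    (hfix : P.bisimFunctional k m = m) (n : ℕ) (g g' : P.GState) :
    P.logicalDist k g g' ≤ n * m g g' + 2 * k ^ n := by
  refine ciSup_le fun F => ?_
  obtain ⟨F', h1, h2⟩ := exists_lipschitz_FExpr hk hk1 hm hfix n F
  have h3 := abs_le.1 (h1 g)
  have h4 := abs_le.1 (h1 g')
  have h5 := abs_le.1 (h2 g g')
  exact abs_le.2 ⟨by linarith, by linarith⟩

end UpperBound

/-! ### The Skorohod lifting of the logical pseudometric -/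

theorem isUnitLipschitz_one_sub_abs {x : ℝ} (hx : x ∈ Icc (0 : ℝ) 1) :
    IsUnitLipschitz fun y => 1 - |y - x| := by
  refine ⟨fun y hy => ⟨sub_nonneg.2 (abs_sub_le_one_of_mem_Icc hy hx),
    sub_le_self _ (abs_nonneg _)⟩, fun y _ z _ => ?_⟩
  rw [sub_sub_sub_cancel_left, abs_sub_comm]
  simpa using abs_abs_sub_abs_le (y - x) (z - x)

theorem FVSeq.exists_finset_net (ω : P.FVSeq) {C : Set ℝ≥0} (hC : BddAbove C) {ε : ℝ}
    (hε : 0 < ε) : ∃ D : Finset ℝ≥0, (D : Set ℝ≥0) ⊆ C ∧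
      ∀ u ∈ C, ∃ v ∈ D, ω.index u = ω.index v ∧ |(u : ℝ) - v| ≤ ε := by
  obtain ⟨T, hT⟩ := hC
  let f : ℝ≥0 → ℕ × ℕ := fun u => (ω.index u, ⌊(u : ℝ) / ε⌋₊)
  have hf : (f '' C).Finite := by
    refine ((finite_Iic (ω.index T)).prod (finite_Iic ⌊(T : ℝ) / ε⌋₊)).subset ?_
    rintro _ ⟨u, hu, rfl⟩
    have h1 : (u : ℝ) ≤ T := hT hu
    exact ⟨ω.index_mono (hT hu), Nat.floor_le_floor (div_le_div_of_nonneg_right h1 hε.le)⟩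
  obtain ⟨D, hDC, hD⟩ := exists_subset_bijOn C f
  have hDf : D.Finite := hD.finite_iff_finite.2 hf
  refine ⟨hDf.toFinset, by simpa using hDC, fun u hu => ?_⟩
  obtain ⟨v, hv, hvu⟩ := hD.surjOn (mem_image_of_mem f hu)
  refine ⟨v, by simpa using hv, (congrArg Prod.fst hvu).symm, ?_⟩
  have h1 : ⌊(v : ℝ) / ε⌋₊ = ⌊(u : ℝ) / ε⌋₊ := congrArg Prod.snd hvu
  have h2 := Nat.floor_le (div_nonneg u.2 hε.le : (0 : ℝ) ≤ (u : ℝ) / ε)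
  have h3 := Nat.floor_le (div_nonneg v.2 hε.le : (0 : ℝ) ≤ (v : ℝ) / ε)
  have h4 := Nat.lt_floor_add_one ((u : ℝ) / ε)
  have h5 := Nat.lt_floor_add_one ((v : ℝ) / ε)
  rw [h1] at h3 h5
  have h6 : |(u : ℝ) / ε - v / ε| ≤ 1 := abs_le.2 ⟨by linarith, by linarith⟩
  rwa [← sub_div, abs_div, abs_of_pos hε, div_le_one hε] at h6

theorem exists_FExpr_separating (hk : 0 ≤ k) (hk1 : k ≤ 1) (g : P.GState) {r : ℝ} {ι : Type*}
    (a : ι → P.GState) (D : Finset ι) (h : ∀ i ∈ D, r < P.logicalDist k g (a i)) :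
    ∃ F : FExpr AP, P.evalF k F g = 1 ∧ ∀ i ∈ D, P.evalF k F (a i) ≤ 1 - r := by
  classical
  induction D using Finset.induction_on with
  | empty => exact ⟨.one, by simp [evalF], by simp⟩
  | insert i D hi ih =>
    obtain ⟨F, h1, h2⟩ := ih fun j hj => h j (Finset.mem_insert_of_mem hj)
    obtain ⟨F', hF'⟩ := exists_lt_of_lt_ciSup (h i (Finset.mem_insert_self _ _))
    have hx := (isRegularF_evalF hk hk1 F').mem_Icc g
    refine ⟨.min (.comp _ (isUnitLipschitz_one_sub_abs hx) F') F, ?_, fun j hj => ?_⟩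
    · simp [evalF, h1]
    · simp only [evalF]
      rcases Finset.mem_insert.1 hj with rfl | hj
      · refine (min_le_left _ _).trans ?_
        rw [abs_sub_comm]
        linarith
      · exact (min_le_right _ _).trans (h2 j hj)

theorem exists_GExpr_of_far (hk : 0 ≤ k) (hk1 : k ≤ 1) {ω ω' : P.FVSeq} {r : ℝ} {t : ℝ≥0}
    (h : ∀ t' : ℝ≥0, |(t : ℝ) - t'| ≤ r → r < P.logicalDist k (ω.trace t) (ω'.trace t')) {ε : ℝ}
    (hε : 0 < ε) : ∃ G : GExpr AP, r - ε ≤ P.evalG k G ω - P.evalG k G ω' := by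
  have hb : BddAbove {u : ℝ≥0 | |(t : ℝ) - u| ≤ r} := by
    refine ⟨Real.toNNReal (t + r), fun u hu => ?_⟩
    have h1 := (abs_le.1 (show |(t : ℝ) - u| ≤ r from hu)).1
    rw [← NNReal.coe_le_coe]
    exact le_trans (by linarith) (Real.le_coe_toNNReal _)
  obtain ⟨D, hD, hnet⟩ := ω'.exists_finset_net hb hε
  obtain ⟨F, h1, h2⟩ := exists_FExpr_separating hk hk1 (ω.trace t) (r := r) ω'.trace D
    fun v hv => h v (hD hv)
  have hF := isRegularF_evalF (P := P) hk hk1 F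
  refine ⟨.smooth F t, ?_⟩
  simp only [evalG]
  change _ ≤ smoothing (P.evalF k F) t ω - smoothing (P.evalF k F) t ω'
  have h3 := le_smoothing hF.mem_Icc t ω
  have h4 : smoothing (P.evalF k F) t ω' ≤ 1 - r + ε := by
    refine ciSup_le fun u => ?_
    by_cases hu : |(t : ℝ) - u| ≤ r
    · obtain ⟨v, hv, hi, huv⟩ := hnet u hu
      have h5 := (abs_le.1 (hF.evolveLipschitz.abs_sub_le hi)).2
      linarith [h2 v hv, abs_nonneg ((u : ℝ) - t)]
    · rw [abs_sub_comm] at hu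
      linarith [(hF.mem_Icc (ω'.trace u)).2]
  linarith

theorem exists_GExpr_skorohod_le (hk : 0 ≤ k) (hk1 : k ≤ 1) (ω ω' : P.FVSeq) {ε : ℝ}
    (hε : 0 < ε) : ∃ G : GExpr AP,
      skorohod (P.logicalDist k) ω.trace ω'.trace ≤ |P.evalG k G ω - P.evalG k G ω'| + ε := by
  have hd := isPseudometric_logicalDist (P := P) hk hk1
  rcases exists_of_lt_skorohod hd.nonneg (sub_lt_self (skorohod _ ω.trace ω'.trace) (half_pos hε))
    with ⟨t, ht⟩ | ⟨t, ht⟩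
  · obtain ⟨G, hG⟩ := exists_GExpr_of_far hk hk1 ht (half_pos hε)
    exact ⟨G, by linarith [le_abs_self (P.evalG k G ω - P.evalG k G ω')]⟩
  · obtain ⟨G, hG⟩ := exists_GExpr_of_far (ω := ω') (ω' := ω) hk hk1 (t := t) (fun u hu => by
      rw [hd.symm]
      rw [abs_sub_comm] at hu
      exact ht u hu) (half_pos hε)
    exact ⟨G, by linarith [neg_abs_le (P.evalG k G ω - P.evalG k G ω')]⟩

end GSMP

/-! ### Lattices of functions on compact sets -/

/-- A form of the Kakutani–Stone theorem: in a lattice of continuous functions, a function that can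
be approximated at any two points can be approximated uniformly on a compact set. -/
theorem IsCompact.exists_mem_lattice_abs_sub_lt {X : Type*} [TopologicalSpace X] {A : Set X}
    (hA : IsCompact A) {L : Set (X → ℝ)} (hL : L.Nonempty)
    (hmin : ∀ a ∈ L, ∀ b ∈ L, (fun x => min (a x) (b x)) ∈ L)
    (hmax : ∀ a ∈ L, ∀ b ∈ L, (fun x => max (a x) (b x)) ∈ L)
    (hcont : ∀ a ∈ L, ContinuousOn a A) {h : X → ℝ} (hh : ContinuousOn h A) {ε : ℝ}
    (hsep : ∀ x ∈ A, ∀ y ∈ A, ∃ a ∈ L, |a x - h x| < ε ∧ |a y - h y| < ε) :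
    ∃ a ∈ L, ∀ z ∈ A, |a z - h z| < ε := by
  have hupper : ∀ x ∈ A, ∃ a ∈ L, h x - ε < a x ∧ ∀ z ∈ A, a z < h z + ε := by
    intro x hx
    refine hA.induction_on (p := fun s => ∃ a ∈ L, h x - ε < a x ∧ ∀ z ∈ s, a z < h z + ε)
      ?_ ?_ ?_ ?_
    · obtain ⟨a, ha, h1, -⟩ := hsep x hx x hx
      exact ⟨a, ha, by linarith [(abs_lt.1 h1).1], by simp⟩
    · rintro s t hst ⟨a, ha, h1, h2⟩
      exact ⟨a, ha, h1, fun z hz => h2 z (hst hz)⟩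
    · rintro s t ⟨a, ha, h1, h2⟩ ⟨b, hb, h3, h4⟩
      refine ⟨_, hmin a ha b hb, lt_min h1 h3, fun z hz => ?_⟩
      rcases hz with hz | hz
      · exact (min_le_left _ _).trans_lt (h2 z hz)
      · exact (min_le_right _ _).trans_lt (h4 z hz)
    · intro y hy
      obtain ⟨a, ha, h1, h2⟩ := hsep x hx y hy
      refine ⟨{z | a z < h z + ε}, ?_, a, ha, by linarith [(abs_lt.1 h1).1], fun z hz => hz⟩
      exact Tendsto.eventually_lt (hcont a ha y hy) ((hh y hy).add_const ε)
        (by linarith [(abs_lt.1 h2).2])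
  have hlower : ∃ a ∈ L, (∀ z ∈ A, a z < h z + ε) ∧ ∀ z ∈ A, h z - ε < a z := by
    rcases A.eq_empty_or_nonempty with rfl | ⟨x₀, hx₀⟩
    · obtain ⟨a, ha⟩ := hL
      exact ⟨a, ha, by simp, by simp⟩
    refine hA.induction_on
      (p := fun s => ∃ a ∈ L, (∀ z ∈ A, a z < h z + ε) ∧ ∀ z ∈ s, h z - ε < a z) ?_ ?_ ?_ ?_
    · obtain ⟨a, ha, -, h1⟩ := hupper x₀ hx₀
      exact ⟨a, ha, h1, by simp⟩
    · rintro s t hst ⟨a, ha, h1, h2⟩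
      exact ⟨a, ha, h1, fun z hz => h2 z (hst hz)⟩
    · rintro s t ⟨a, ha, h1, h2⟩ ⟨b, hb, h3, h4⟩
      refine ⟨_, hmax a ha b hb, fun z hz => max_lt (h1 z hz) (h3 z hz), fun z hz => ?_⟩
      rcases hz with hz | hz
      · exact (h2 z hz).trans_le (le_max_left _ _)
      · exact (h4 z hz).trans_le (le_max_right _ _)
    · intro y hy
      obtain ⟨a, ha, h1, h2⟩ := hupper y hy
      refine ⟨{z | h z - ε < a z}, ?_, a, ha, h2, fun z hz => hz⟩
      exact Tendsto.eventually_lt ((hh y hy).sub_const ε) (hcont a ha y hy) h1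
  obtain ⟨a, ha, h1, h2⟩ := hlower
  exact ⟨a, ha, fun z hz => abs_lt.2 ⟨by linarith [h2 z hz], by linarith [h1 z hz]⟩⟩

namespace GSMP

theorem isUnitLipschitz_one_sub : IsUnitLipschitz fun x => 1 - x :=
  ⟨fun x hx => ⟨sub_nonneg.2 hx.2, sub_le_self _ hx.1⟩, fun x _ y _ => by
    rw [sub_sub_sub_cancel_left, abs_sub_comm]⟩

theorem exists_isUnitLipschitz_interpolating {a b u v ε : ℝ} (hu : u ∈ Icc (0 : ℝ) 1)
    (hv : v ∈ Icc (0 : ℝ) 1) (hε : 0 ≤ ε) (h : |u - v| ≤ |a - b| + ε) :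
    ∃ θ : ℝ → ℝ, IsUnitLipschitz θ ∧ |θ a - u| ≤ ε ∧ |θ b - v| ≤ ε := by
  have hl (x y : ℝ) : |(|x - a| - |y - a|)| ≤ |x - y| := by
    simpa using abs_abs_sub_abs_le (x - a) (y - a)
  rw [abs_sub_comm a b] at h
  rcases le_total u v with huv | huv
  · refine ⟨fun x => min v (u + |x - a|), ⟨fun x _ => ?_, fun x _ y _ => ?_⟩, ?_, ?_⟩
    · exact ⟨le_min hv.1 (add_nonneg hu.1 (abs_nonneg _)), (min_le_left _ _).trans hv.2⟩
    · refine abs_min_sub_min_le (by simp) ?_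
      rw [add_sub_add_left_eq_sub]
      exact hl x y
    · simpa [huv] using hε
    · rw [abs_sub_comm] at h
      have h1 := (le_abs_self _).trans h
      have h2 : v - ε ≤ min v (u + |b - a|) := le_min (by linarith) (by linarith)
      exact abs_le.2 ⟨by linarith, by linarith [min_le_left v (u + |b - a|)]⟩
  · refine ⟨fun x => max v (u - |x - a|), ⟨fun x _ => ?_, fun x _ y _ => ?_⟩, ?_, ?_⟩
    · exact ⟨hv.1.trans (le_max_left _ _), max_le hv.2 ((sub_le_self _ (abs_nonneg _)).trans hu.2)⟩
    · refine (abs_max_sub_max_le_max _ _ _ _).trans (max_le (by simp) ?_)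
      rw [sub_sub_sub_cancel_left, abs_sub_comm]
      exact hl x y
    · simpa [huv] using hε
    · have h1 := (le_abs_self _).trans h
      have h2 : max v (u - |b - a|) ≤ v + ε := max_le (by linarith) (by linarith)
      exact abs_le.2 ⟨by linarith [le_max_left v (u - |b - a|)], by linarith⟩

/-- A measurable function that is nonexpansive for the pseudometric given by countably many
functions of a lattice is approximated by functions of the lattice. -/
theorem exists_mem_lattice_of_nonexpansive {Ω : Type*} [MeasurableSpace Ω] [StandardBorelSpace Ω]
    {L L₀ : Set (Ω → ℝ)} (hL : L.Nonempty) (h01 : ∀ a ∈ L, ∀ x, a x ∈ Icc (0 : ℝ) 1)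
    (hmeas : ∀ a ∈ L, Measurable a)
    (hmin : ∀ a ∈ L, ∀ b ∈ L, (fun x => min (a x) (b x)) ∈ L)
    (hcomp : ∀ θ, IsUnitLipschitz θ → ∀ a ∈ L, (fun x => θ (a x)) ∈ L)
    (hL₀ : L₀ ⊆ L) (hcount : L₀.Countable) {h : Ω → ℝ} (hm : Measurable h)
    (hh : ∀ x, h x ∈ Icc (0 : ℝ) 1)
    (hsep : ∀ x y, ∀ ε > 0, ∃ a ∈ L₀, |h x - h y| ≤ |a x - a y| + ε)
    (ρ : Measure Ω) [IsFiniteMeasure ρ] {ε : ℝ} (hε : 0 < ε) :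
    ∃ a ∈ L, ∃ A : Set Ω, MeasurableSet A ∧ ρ Aᶜ ≤ ENNReal.ofReal ε ∧
      ∀ x ∈ A, |a x - h x| ≤ ε := by
  have : Countable L₀ := hcount.to_subtype
  obtain ⟨τ, hB, hP⟩ := StandardBorelSpace.polish (α := Ω)
  have hΦ : Measurable fun x : Ω => (h x, fun a : L₀ => a.1 x) :=
    hm.prodMk (measurable_pi_lambda _ fun a => hmeas a.1 (hL₀ a.2))
  obtain ⟨τ', hle, hcont, hP'⟩ := hΦ.exists_continuous
  have hB' : @BorelSpace Ω τ' _ :=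
    @BorelSpace.mk Ω τ' _ (hB.measurable_eq.trans (borel_eq_borel_of_le hP' hP hle).symm)
  clear hle hB hP
  clear τ
  have hhc : Continuous h := continuous_fst.comp hcont
  have hac (a) (ha : a ∈ L₀) : Continuous a :=
    (continuous_apply (⟨a, ha⟩ : L₀)).comp (continuous_snd.comp hcont)
  obtain ⟨A, -, hAc, hAρ⟩ := MeasurableSet.univ.exists_isCompact_sdiff_lt (μ := ρ)
    (measure_ne_top ρ _) (ENNReal.ofReal_pos.2 hε).ne'
  have hcompL : ∀ θ, IsUnitLipschitz θ → ∀ a ∈ {a ∈ L | Continuous a},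
      (fun x => θ (a x)) ∈ {a ∈ L | Continuous a} := fun θ hθ a ha =>
    ⟨hcomp θ hθ a ha.1, hθ.continuousOn.comp_continuous ha.2 (h01 a ha.1)⟩
  have hminL : ∀ a ∈ {a ∈ L | Continuous a}, ∀ b ∈ {a ∈ L | Continuous a},
      (fun x => min (a x) (b x)) ∈ {a ∈ L | Continuous a} := fun a ha b hb =>
    ⟨hmin a ha.1 b hb.1, ha.2.min hb.2⟩
  have hLne : {a ∈ L | Continuous a}.Nonempty := by
    obtain ⟨a, ha⟩ := hL
    have h0 : IsUnitLipschitz fun _ => 0 :=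
      ⟨fun x _ => ⟨le_rfl, zero_le_one⟩, fun x _ y _ => by simp⟩
    exact ⟨_, hcomp _ h0 a ha, continuous_const⟩
  obtain ⟨a, ha, haA⟩ := hAc.exists_mem_lattice_abs_sub_lt (L := {a ∈ L | Continuous a}) hLne
    hminL (fun a ha b hb => by
      have h1 := hcompL _ isUnitLipschitz_one_sub _ (hminL _
        (hcompL _ isUnitLipschitz_one_sub a ha) _ (hcompL _ isUnitLipschitz_one_sub b hb))
      convert! h1 using 2 with x
      rcases le_total (a x) (b x) with hab | hab
      · rw [max_eq_right hab, min_eq_right (by linarith)]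
        ring
      · rw [max_eq_left hab, min_eq_left (by linarith)]
        ring)
    (fun a ha => ha.2.continuousOn) hhc.continuousOn (ε := ε) (fun x _ y _ => by
      obtain ⟨a, ha, hxy⟩ := hsep x y (ε / 2) (half_pos hε)
      obtain ⟨θ, hθ, h1, h2⟩ := exists_isUnitLipschitz_interpolating (hh x) (hh y)
        (half_pos hε).le hxy
      exact ⟨_, hcompL θ hθ a ⟨hL₀ ha, hac a ha⟩, h1.trans_lt (half_lt_self hε),
        h2.trans_lt (half_lt_self hε)⟩)
  refine ⟨a, ha.1, A, hAc.isClosed.measurableSet, ?_, fun x hx => (haA x hx).le⟩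
  rw [compl_eq_univ_sdiff]
  exact hAρ.le

theorem abs_integral_sub_le_of_close {Z : Type*} [MeasurableSpace Z] {μ : Measure Z}
    [IsProbabilityMeasure μ] {a b : Z → ℝ} (ha : Measurable a) (hb : Measurable b)
    (ha01 : ∀ z, a z ∈ Icc (0 : ℝ) 1) (hb01 : ∀ z, b z ∈ Icc (0 : ℝ) 1) {A : Set Z}
    (hA : MeasurableSet A) {ε : ℝ} (hε : 0 ≤ ε) (hμ : μ Aᶜ ≤ ENNReal.ofReal ε)
    (h : ∀ z ∈ A, |a z - b z| ≤ ε) : |∫ z, a z ∂μ - ∫ z, b z ∂μ| ≤ 2 * ε := by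
  have hia := integrable_of_mem_Icc (μ := μ) ha ha01
  have hib := integrable_of_mem_Icc (μ := μ) hb hb01
  have hi : Integrable (Aᶜ.indicator fun _ => (1 : ℝ)) μ :=
    (integrable_const _).indicator hA.compl
  calc |∫ z, a z ∂μ - ∫ z, b z ∂μ| = |∫ z, (a z - b z) ∂μ| := by rw [integral_sub hia hib]
    _ ≤ ∫ z, |a z - b z| ∂μ := abs_integral_le_integral_abs
    _ ≤ ∫ z, (ε + Aᶜ.indicator (fun _ => (1 : ℝ)) z) ∂μ := by
        refine integral_mono (hia.sub hib).abs ((integrable_const _).add hi) fun z => ?_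
        by_cases hz : z ∈ A
        · simpa [hz] using h z hz
        · have := abs_sub_le_one_of_mem_Icc (ha01 z) (hb01 z)
          simp only [mem_compl_iff, hz, not_false_eq_true, indicator_of_mem]
          linarith
    _ = ε + μ.real Aᶜ := by
        rw [integral_add (integrable_const _) hi, integral_indicator_const _ hA.compl]
        simp
    _ ≤ 2 * ε := by
        have : μ.real Aᶜ ≤ ε := ENNReal.toReal_le_of_le_ofReal hε hμ
        linarith

/-! ### Countably many expressions suffice -/

theorem exists_dense_isUnitLipschitz : ∃ θ : ℕ → {h : ℝ → ℝ // IsUnitLipschitz h},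
    ∀ h, IsUnitLipschitz h → ∀ ε > 0, ∃ n, ∀ x ∈ Icc (0 : ℝ) 1, |h x - (θ n).1 x| ≤ ε := by
  let r : {h : ℝ → ℝ // IsUnitLipschitz h} → C(Icc (0 : ℝ) 1, ℝ) := fun h =>
    ⟨(Icc (0 : ℝ) 1).domRestrict h.1, continuousOn_iff_continuous_domRestrict.1 h.2.continuousOn⟩
  let : TopologicalSpace {h : ℝ → ℝ // IsUnitLipschitz h} := TopologicalSpace.induced r inferInstance
  have : SecondCountableTopology {h : ℝ → ℝ // IsUnitLipschitz h} :=
    TopologicalSpace.secondCountableTopology_induced _ _ r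
  have : Nonempty {h : ℝ → ℝ // IsUnitLipschitz h} := ⟨⟨_, isUnitLipschitz_one_sub⟩⟩
  have hr : Continuous r := continuous_induced_dom
  refine ⟨TopologicalSpace.denseSeq _, fun h hh ε hε => ?_⟩
  obtain ⟨n, hn⟩ := (TopologicalSpace.denseRange_denseSeq
    {h : ℝ → ℝ // IsUnitLipschitz h}).exists_mem_open
    (Metric.isOpen_ball.preimage hr) ⟨⟨h, hh⟩, Metric.mem_ball_self (x := r ⟨h, hh⟩) hε⟩
  refine ⟨n, fun x hx => ?_⟩
  have h1 := (ContinuousMap.dist_apply_le_dist (f := r (TopologicalSpace.denseSeq _ n))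
    (g := r ⟨h, hh⟩) ⟨x, hx⟩).trans (le_of_lt hn)
  rw [dist_comm, Real.dist_eq] at h1
  exact h1

section Countable

variable {AP : Type*}

/-- The expressions of bounded size with constituents from given countable sets. -/
def exprsFrom (R : Set AP) (θ : ℕ → {h : ℝ → ℝ // IsUnitLipschitz h}) (q : ℕ → ℝ≥0) :
    ℕ → Set (FExpr AP) × Set (GExpr AP)
  | 0 => ({.one} ∪ FExpr.prop '' R, ∅)
  | n + 1 =>
    ((exprsFrom R θ q n).1 ∪ image2 .min (exprsFrom R θ q n).1 (exprsFrom R θ q n).1 ∪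
      (⋃ i, FExpr.comp (θ i).1 (θ i).2 '' (exprsFrom R θ q n).1) ∪
        FExpr.integral '' (exprsFrom R θ q n).2,
    (exprsFrom R θ q n).2 ∪ image2 .min (exprsFrom R θ q n).2 (exprsFrom R θ q n).2 ∪
      (⋃ i, GExpr.comp (θ i).1 (θ i).2 '' (exprsFrom R θ q n).2) ∪
        ⋃ i, (fun F => GExpr.smooth F (q i)) '' (exprsFrom R θ q n).1)

variable {R : Set AP} {θ : ℕ → {h : ℝ → ℝ // IsUnitLipschitz h}} {q : ℕ → ℝ≥0}

theorem countable_exprsFrom (hR : R.Countable) (n : ℕ) :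
    (exprsFrom R θ q n).1.Countable ∧ (exprsFrom R θ q n).2.Countable := by
  induction n with
  | zero => exact ⟨(countable_singleton _).union (hR.image _), countable_empty⟩
  | succ n ih =>
    exact ⟨((ih.1.union (ih.1.image2 ih.1 _)).union (countable_iUnion fun i => ih.1.image _)).union
      (ih.2.image _), ((ih.2.union (ih.2.image2 ih.2 _)).union
        (countable_iUnion fun i => ih.2.image _)).union (countable_iUnion fun i => ih.1.image _)⟩

theorem exprsFrom_mono : Monotone (exprsFrom R θ q) :=
  monotone_nat_of_le_succ fun _ =>
    ⟨fun _ h => Or.inl (Or.inl (Or.inl h)), fun _ h => Or.inl (Or.inl (Or.inl h))⟩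

theorem exists_countable_props {S E : Type*} [Fintype S] (P : GSMP S E AP) :
    ∃ R : Set AP, R.Countable ∧ ∀ p, ∃ p' ∈ R, ∀ s, p ∈ P.props s ↔ p' ∈ P.props s := by
  let f : AP → Set S := fun p => {s | p ∈ P.props s}
  obtain ⟨R, -, hR⟩ := exists_subset_bijOn univ f
  refine ⟨R, (hR.finite_iff_finite.2 (toFinite _)).countable, fun p => ?_⟩
  obtain ⟨p', hp', h⟩ := hR.surjOn (mem_image_of_mem f (mem_univ p))
  exact ⟨p', hp', fun s => (Set.ext_iff.1 h s).symm⟩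

variable {S E : Type*} [Fintype S] {P : GSMP S E AP} {k : ℝ}

mutual

theorem exists_FExpr_close (hk : 0 ≤ k) (hk1 : k ≤ 1)
    (hR : ∀ p, ∃ p' ∈ R, ∀ s, p ∈ P.props s ↔ p' ∈ P.props s)
    (hθ : ∀ h, IsUnitLipschitz h → ∀ ε > 0, ∃ n, ∀ x ∈ Icc (0 : ℝ) 1, |h x - (θ n).1 x| ≤ ε)
    (hq : DenseRange q) : ∀ (F : FExpr AP) (ε : ℝ), 0 < ε → ∃ n, ∃ F' ∈ (exprsFrom R θ q n).1,
      ∀ g, |P.evalF k F g - P.evalF k F' g| ≤ ε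
  | .one, ε, hε => ⟨0, .one, Or.inl rfl, fun g => by simpa using hε.le⟩
  | .prop p, ε, hε => by
    obtain ⟨p', hp', h⟩ := hR p
    refine ⟨0, .prop p', Or.inr ⟨p', hp', rfl⟩, fun g => ?_⟩
    have h' : P.evalF k (.prop p) g = P.evalF k (.prop p') g := by
      simp only [evalF]
      congr 1
      exact propext (h _)
    rw [h', sub_self, abs_zero]
    exact hε.le
  | .min F₁ F₂, ε, hε => by
    obtain ⟨n₁, F₁', h1, h2⟩ := exists_FExpr_close hk hk1 hR hθ hq F₁ ε hε
    obtain ⟨n₂, F₂', h3, h4⟩ := exists_FExpr_close hk hk1 hR hθ hq F₂ ε hε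
    refine ⟨max n₁ n₂ + 1, .min F₁' F₂', Or.inl (Or.inl (Or.inr ⟨F₁',
      (exprsFrom_mono (le_max_left n₁ n₂)).1 h1, F₂',
      (exprsFrom_mono (le_max_right n₁ n₂)).1 h3, rfl⟩)), fun g => ?_⟩
    simp only [evalF]
    exact abs_min_sub_min_le (h2 g) (h4 g)
  | .comp h hh F, ε, hε => by
    obtain ⟨n, F', h1, h2⟩ := exists_FExpr_close hk hk1 hR hθ hq F (ε / 2) (half_pos hε)
    obtain ⟨i, hi⟩ := hθ h hh (ε / 2) (half_pos hε)
    have hF := (isRegularF_evalF (P := P) hk hk1 F).mem_Icc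
    have hF' := (isRegularF_evalF (P := P) hk hk1 F').mem_Icc
    refine ⟨n + 1, .comp (θ i).1 (θ i).2 F', Or.inl (Or.inr (mem_iUnion.2 ⟨i, F', h1, rfl⟩)),
      fun g => ?_⟩
    simp only [evalF]
    refine (abs_sub_le _ (h (P.evalF k F' g)) _).trans ?_
    linarith [(hh.2 _ (hF g) _ (hF' g)).trans (h2 g), hi _ (hF' g)]
  | .integral G, ε, hε => by
    obtain ⟨n, G', h1, h2⟩ := exists_GExpr_close hk hk1 hR hθ hq G ε hε
    refine ⟨n + 1, .integral G', Or.inr ⟨G', h1, rfl⟩, fun g => ?_⟩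
    have hG := isRegularG_evalG (P := P) hk hk1 G
    have hG' := isRegularG_evalG (P := P) hk hk1 G'
    have h3 := abs_integral_sub_integral_le (μ := P.tracesLaw g)
      (integrable_of_mem_Icc hG.measurable hG.mem_Icc)
      (integrable_of_mem_Icc hG'.measurable hG'.mem_Icc) (Eventually.of_forall h2)
    simp only [evalF]
    rw [← mul_sub, abs_mul, abs_of_nonneg hk]
    exact (mul_le_of_le_one_left (abs_nonneg _) hk1).trans h3

theorem exists_GExpr_close (hk : 0 ≤ k) (hk1 : k ≤ 1)
    (hR : ∀ p, ∃ p' ∈ R, ∀ s, p ∈ P.props s ↔ p' ∈ P.props s)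
    (hθ : ∀ h, IsUnitLipschitz h → ∀ ε > 0, ∃ n, ∀ x ∈ Icc (0 : ℝ) 1, |h x - (θ n).1 x| ≤ ε)
    (hq : DenseRange q) : ∀ (G : GExpr AP) (ε : ℝ), 0 < ε → ∃ n, ∃ G' ∈ (exprsFrom R θ q n).2,
      ∀ ω, |P.evalG k G ω - P.evalG k G' ω| ≤ ε
  | .smooth F t, ε, hε => by
    obtain ⟨n, F', h1, h2⟩ := exists_FExpr_close hk hk1 hR hθ hq F (ε / 2) (half_pos hε)
    obtain ⟨i, hi⟩ := hq.exists_mem_open (Metric.isOpen_ball (x := t) (ε := ε / 2))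
      ⟨t, Metric.mem_ball_self (half_pos hε)⟩
    refine ⟨n + 1, .smooth F' (q i), Or.inr (mem_iUnion.2 ⟨i, F', h1, rfl⟩), fun ω => ?_⟩
    have h3 := abs_smoothing_sub_smoothing_le (isRegularF_evalF hk hk1 F).mem_Icc
      (isRegularF_evalF hk hk1 F').mem_Icc h2 t (q i) ω
    have h4 : |(t : ℝ) - q i| < ε / 2 := by
      rw [abs_sub_comm]
      exact hi
    simp only [evalG]
    exact h3.trans (by linarith)
  | .min G₁ G₂, ε, hε => by
    obtain ⟨n₁, G₁', h1, h2⟩ := exists_GExpr_close hk hk1 hR hθ hq G₁ ε hε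
    obtain ⟨n₂, G₂', h3, h4⟩ := exists_GExpr_close hk hk1 hR hθ hq G₂ ε hε
    refine ⟨max n₁ n₂ + 1, .min G₁' G₂', Or.inl (Or.inl (Or.inr ⟨G₁',
      (exprsFrom_mono (le_max_left n₁ n₂)).2 h1, G₂',
      (exprsFrom_mono (le_max_right n₁ n₂)).2 h3, rfl⟩)), fun ω => ?_⟩
    simp only [evalG]
    exact abs_min_sub_min_le (h2 ω) (h4 ω)
  | .comp h hh G, ε, hε => by
    obtain ⟨n, G', h1, h2⟩ := exists_GExpr_close hk hk1 hR hθ hq G (ε / 2) (half_pos hε)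
    obtain ⟨i, hi⟩ := hθ h hh (ε / 2) (half_pos hε)
    have hG := (isRegularG_evalG (P := P) hk hk1 G).mem_Icc
    have hG' := (isRegularG_evalG (P := P) hk hk1 G').mem_Icc
    refine ⟨n + 1, .comp (θ i).1 (θ i).2 G', Or.inl (Or.inr (mem_iUnion.2 ⟨i, G', h1, rfl⟩)),
      fun ω => ?_⟩
    simp only [evalG]
    refine (abs_sub_le _ (h (P.evalG k G' ω)) _).trans ?_
    linarith [(hh.2 _ (hG ω) _ (hG' ω)).trans (h2 ω), hi _ (hG' ω)]

end

theorem exists_countable_dense_GExpr (hk : 0 ≤ k) (hk1 : k ≤ 1) :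
    ∃ 𝒟 : Set (GExpr AP), 𝒟.Countable ∧ ∀ (G : GExpr AP) (ε : ℝ), 0 < ε → ∃ G' ∈ 𝒟,
      ∀ ω, |P.evalG k G ω - P.evalG k G' ω| ≤ ε := by
  obtain ⟨R, hRc, hR⟩ := exists_countable_props P
  obtain ⟨θ, hθ⟩ := exists_dense_isUnitLipschitz
  refine ⟨⋃ n, (exprsFrom R θ (TopologicalSpace.denseSeq ℝ≥0) n).2,
    countable_iUnion fun n => (countable_exprsFrom hRc n).2, fun G ε hε => ?_⟩
  obtain ⟨n, G', h1, h2⟩ := exists_GExpr_close hk hk1 hR hθ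
    (TopologicalSpace.denseRange_denseSeq ℝ≥0) G ε hε
  exact ⟨G', mem_iUnion.2 ⟨n, h1⟩, h2⟩

end Countable

/-! ### The logical pseudometric is a prefixed point -/

variable {S E AP : Type*} [Fintype S] {P : GSMP S E AP} {k : ℝ}

theorem exists_GExpr_integral_close (hk : 0 ≤ k) (hk1 : k ≤ 1) (μ ν : Measure P.FVSeq)
    [IsProbabilityMeasure μ] [IsProbabilityMeasure ν] {h : P.FVSeq → ℝ} (hm : Measurable h)
    (hh : ∀ ω, h ω ∈ Icc (0 : ℝ) 1)
    (hd : ∀ ω ω', |h ω - h ω'| ≤ skorohod (P.logicalDist k) ω.trace ω'.trace) {ε : ℝ}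
    (hε : 0 < ε) : ∃ G : GExpr AP, |∫ ω, P.evalG k G ω ∂μ - ∫ ω, h ω ∂μ| ≤ ε ∧
      |∫ ω, P.evalG k G ω ∂ν - ∫ ω, h ω ∂ν| ≤ ε := by
  obtain ⟨𝒟, hc, hdense⟩ := exists_countable_dense_GExpr (P := P) hk hk1
  obtain ⟨a, ⟨G, rfl⟩, A, hA, hAρ, hclose⟩ := exists_mem_lattice_of_nonexpansive
    (L := range (P.evalG k)) (L₀ := P.evalG k '' 𝒟) (ρ := μ + ν) ⟨_, .smooth .one 0, rfl⟩
    (by rintro _ ⟨G, rfl⟩; exact (isRegularG_evalG hk hk1 G).mem_Icc)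
    (by rintro _ ⟨G, rfl⟩; exact (isRegularG_evalG hk hk1 G).measurable)
    (by
      rintro _ ⟨G₁, rfl⟩ _ ⟨G₂, rfl⟩
      exact ⟨.min G₁ G₂, by funext ω; simp only [evalG]⟩)
    (by
      rintro θ hθ _ ⟨G, rfl⟩
      exact ⟨.comp θ hθ G, by funext ω; simp only [evalG]⟩)
    (image_subset_range _ _) (hc.image _) hm hh
    (fun x y ε hε => by
      obtain ⟨G, hG⟩ := exists_GExpr_skorohod_le (P := P) hk hk1 x y (half_pos hε)
      obtain ⟨G', hG', h1⟩ := hdense G (ε / 4) (by linarith)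
      refine ⟨_, ⟨G', hG', rfl⟩, ((hd x y).trans hG).trans ?_⟩
      have h2 := abs_sub_le (P.evalG k G x) (P.evalG k G' x) (P.evalG k G y)
      have h3 := abs_sub_le (P.evalG k G' x) (P.evalG k G' y) (P.evalG k G y)
      rw [abs_sub_comm (P.evalG k G' y)] at h3
      linarith [h1 x, h1 y]) (half_pos hε)
  have hG := isRegularG_evalG (P := P) hk hk1 G
  rw [Measure.add_apply] at hAρ
  have h1 := abs_integral_sub_le_of_close hG.measurable hm hG.mem_Icc hh hA (half_pos hε).le
    (le_self_add.trans hAρ) hclose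
  have h2 := abs_integral_sub_le_of_close hG.measurable hm hG.mem_Icc hh hA (half_pos hε).le
    (le_add_self.trans hAρ) hclose
  rw [mul_div_cancel₀ _ two_ne_zero] at h1 h2
  exact ⟨G, h1, h2⟩

theorem bisimFunctional_logicalDist_le (hk : 0 ≤ k) (hk1 : k ≤ 1) (g g' : P.GState) :
    P.bisimFunctional k (P.logicalDist k) g g' ≤ P.logicalDist k g g' := by
  have hd := isAdmissible_logicalDist (P := P) hk hk1
  by_cases hp : P.props g.1.1 = P.props g'.1.1
  · rw [bisimFunctional_of_eq hp]
    rcases hk.eq_or_lt with rfl | hk0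
    · rw [zero_mul]
      exact hd.1.nonneg g g'
    rw [← le_div_iff₀' hk0]
    refine wasserstein_le (div_nonneg (hd.1.nonneg g g') hk) fun h hm hh hL => ?_
    refine le_of_forall_pos_le_add fun ε hε => ?_
    obtain ⟨G, h1, h2⟩ := exists_GExpr_integral_close hk hk1 (P.tracesLaw g) (P.tracesLaw g')
      hm hh hL (half_pos hε)
    have h3 := (le_abs_self _).trans (abs_evalF_sub_le (P := P) hk hk1 (.integral G) g g')
    simp only [evalF] at h3
    rw [← mul_sub, ← le_div_iff₀' hk0] at h3
    linarith [(abs_le.1 h1).1, (abs_le.1 h2).2]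
  · rw [bisimFunctional_of_ne hp, hd.2 g g' hp]

end GSMP

theorem mainTheorem1 {S E AP : Type*} [Fintype S] (P : GSMP S E AP) (k : ℝ) (hk : 0 < k)
    (hk' : k ≤ 1 / 2) :
    GSMP.IsPseudometric (P.logicalDist k) ∧
      ∃ m : P.GState → P.GState → ℝ, P.IsMaximumFixedPoint k m ∧
        GSMP.inducedUniformity (P.logicalDist k) = GSMP.inducedUniformity m := by
  have hk1 : k ≤ 1 := by linarith
  have hd := GSMP.isAdmissible_logicalDist (P := P) hk.le hk1
  obtain ⟨m, hm, hfix, hleast⟩ := GSMP.exists_least_prefixedPoint (P := P) hk.le hk1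
  refine ⟨hd.1, m, ⟨hm, hfix, fun m' h1 h2 => hleast m' h1 fun g g' => by rw [h2]⟩, ?_⟩
  have hle := hleast _ hd (GSMP.bisimFunctional_logicalDist_le hk.le hk1)
  ext U
  constructor
  · rintro ⟨ε, hε, hU⟩
    obtain ⟨n, hn⟩ := exists_pow_lt_of_lt_one (show 0 < ε / 4 by linarith)
      (show k < 1 by linarith)
    have hn1 : (0 : ℝ) < n + 1 := by positivity
    refine ⟨ε / (2 * (n + 1)), by positivity, fun p hp => hU ?_⟩
    have h1 := GSMP.logicalDist_le hk.le hk1 hm hfix n p.1 p.2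
    have h2 : m p.1 p.2 < ε / (2 * (n + 1)) := hp
    rw [lt_div_iff₀ (by positivity)] at h2
    have h3 := hm.1.nonneg p.1 p.2
    change P.logicalDist k p.1 p.2 < ε
    linarith
  · rintro ⟨ε, hε, hU⟩
    exact ⟨ε, hε, fun p hp => hU ((hle p.1 p.2).trans_lt hp)⟩
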